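/- **Setting.** Let $\mathcal S\subset\{-1,0,1\}^2\setminus\{(0,0)\}$ be a non-singular set of steps, i.e. $\mathcal S$ is contained in no closed half-plane $\{ai+bj\ge 0\}$ with $(a,b)\neq(0,0)$ (up to exchanging the coordinates there are $74$ such sets), and let $z\in(0,1/|\mathcal S|)$. Let $q(i,j;n)$ be the number of $n$-step walks with steps in $\mathcal S$ from $(0,0)$ to $(i,j)$ staying in $\mathbf Z_+^2$, and put $$Q(x,y;z)=\sum_{i,j,n\ge0}q(i,j;n)x^iy^jz^n,\qquad K(x,y;z)=xyz\Big[\sum_{(i,j)\in\mathcal S}x^iy^j-\frac1z\Big].$$ Let $d(x)$ (resp. $\widetilde d(y)$) be the discriminant of $K$ as a quadratic polynomial in $y$ (resp. in $x$). Its four roots $x_1,\dots,x_4$ (resp. $y_1,\dots,y_4$), with the fourth one equal to $\infty$ if the degree is $3$, are real and are numbered so that $-1<x_1<x_2<1<x_3$, and $x_4\in(x_3,\infty]\cup(-\infty,-1)$ (and similarly for the $y_i$). Let $$\omega_1=i\int_{x_1}^{x_2}\frac{dx}{\sqrt{-d(x)}},\quad \omega_2=\int_{x_2}^{x_3}\frac{dx}{\sqrt{d(x)}},\quad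 \omega_3=\int_{X(y_1)}^{x_1}\frac{dx}{\sqrt{d(x)}},\quad \omega_{y_2}=\frac{\omega_1+\omega_2+\omega_3}2,$$ where $X(y_1)\in\mathbf R\cup\{\infty\}$ is the double root of $K(\cdot,y_1;z)$ (if $X(y_1)=\infty$ the last integral is over $(-\infty,x_1]$). Let $y(\omega)=g_y^{-1}(\wp(\omega-\omega_3/2))$, where $\wp$ is the Weierstrass function with periods $\omega_1,\omega_2$, and $g_y(t)=\widetilde d''(y_4)/6+\widetilde d'(y_4)/(t-y_4)$ if $y_4\ne\infty$, $g_y(t)=\widetilde d''(0)/6+\widetilde d'''(0)t/6$ if $y_4=\infty$. Let $\Delta_y$ be the strip $\{\omega : |y(\omega)|<1,\ \omega_3/2\le\operatorname{Re}\omega<\omega_3/2+\omega_2\}$, and let $r_y$ be the meromorphic continuation to $\mathbf C$ of the function $\omega\mapsto K(0,y(\omega);z)\,Q(0,y(\omega);z)$ on $\Delta_y$. **Theorem.** Let $(P_m)_{m\ge1}$ be parallelograms such that (i) $P_1\subset P_2\subset\cdots$; (ii) $\bigcup_{m\ge1}P_m=\mathbf C$; (iii) every $P_m$ is centered at $\omega_{y_2}$;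 (iv) there are constants $C_1,C_2>0$ such that for all $m\ge1$ $$\sup_{\omega\in\partial P_m}|r_y(\omega)|\le C_1m,\qquad \inf_{\omega\in\partial P_m}|\omega-\omega_{y_2}|\ge C_2m .$$ Then each $P_m$ contains only finitely many poles $d_i$ of $r_y$ and, $R_{d_i,y}(\omega)=\sum_{k<0}g_k(\omega-d_i)^k$ denoting the principal part of $r_y=\sum_k g_k(\omega-d_i)^k$ at $d_i$, $$r_y(\omega)-r_y(\omega_{y_2})=\lim_{m\to\infty}\ \sum_{d_i\in P_m}\big\{R_{d_i,y}(\omega)-R_{d_i,y}(\omega_{y_2})\big\},\qquad \omega\in\mathbf C .$$ When $\omega$ is itself a pole, the equality holds with $r_y(\omega)$ read as the constant coefficient of the Laurent expansion of $r_y$ at $\omega$ and $R_{\omega,y}(\omega)$ read as $0$. -/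

import Mathlib

open Filter Topology Polynomial OnePoint

noncomputable section

namespace QuarterPlane

/-! ### Walks with small steps in the quarter plane -/

/-- `S` is a set of small steps: a subset of `{-1, 0, 1}² \ {(0, 0)}`. -/
def IsSmallStepSet (S : Finset (ℤ × ℤ)) : Prop :=
  ∀ s ∈ S, s.1 ∈ Set.Icc (-1 : ℤ) 1 ∧ s.2 ∈ Set.Icc (-1 : ℤ) 1 ∧ s ≠ (0, 0)

/-- `S` is non-singular: it is contained in no closed half-plane `{a i + b j ≥ 0}`. Up to the
reflection exchanging the coordinates, there are exactly `74` such sets of small steps. -/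
def NonSingular (S : Finset (ℤ × ℤ)) : Prop :=
  ∀ a b : ℝ, (a, b) ≠ (0, 0) → ∃ s ∈ S, a * s.1 + b * s.2 < 0

/-- `q(i, j; n)`: the number of walks with `n` steps taken from `S` that start at the origin,
stay in the quarter plane and end at `(i, j)`. -/
def walkCount (S : Finset (ℤ × ℤ)) (i j n : ℕ) : ℕ :=
  Set.ncard {w : Fin n → ℤ × ℤ |
    (∀ k, w k ∈ S) ∧
    (∀ m : ℕ, m ≤ n →
      0 ≤ (∑ k with k.val < m, w k).1 ∧ 0 ≤ (∑ k with k.val < m, w k).2) ∧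
    ∑ k, w k = ((i : ℤ), (j : ℤ))}

/-- The generating function `Q(x, y; z) = ∑ q(i, j; n) xⁱ yʲ zⁿ`. -/
def genFun (S : Finset (ℤ × ℤ)) (z : ℝ) (x y : ℂ) : ℂ :=
  ∑' t : ℕ × ℕ × ℕ, (walkCount S t.1 t.2.1 t.2.2 : ℂ) * x ^ t.1 * y ^ t.2.1 * (z : ℂ) ^ t.2.2

/-- The kernel `K(x, y; z) = x y z (∑_{(i, j) ∈ S} xⁱ yʲ - 1 / z)`, written as a polynomial. -/
def kernel (S : Finset (ℤ × ℤ)) (z : ℝ) (x y : ℂ) : ℂ :=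
  (∑ s ∈ S, (z : ℂ) * x ^ (s.1 + 1).toNat * y ^ (s.2 + 1).toNat) - x * y

/-- The coefficient of `y ^ (j + 1)` (`j = -1, 0, 1`) in the kernel, as a polynomial in `x`. -/
def kernelCoeff (S : Finset (ℤ × ℤ)) (z : ℝ) (j : ℤ) : ℝ[X] :=
  (∑ s ∈ S with s.2 = j, C z * X ^ (s.1 + 1).toNat) - if j = 0 then X else 0

/-- The step set reflected in the diagonal: passing from `S` to `reflect S` exchanges the roles of
`x` and `y` in the kernel. -/
def reflect (S : Finset (ℤ × ℤ)) : Finset (ℤ × ℤ) := S.image Prod.swap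

/-! ### Branch points -/

/-- The discriminant `d(x)` of the kernel as a quadratic polynomial in `y`. The discriminant
in the other variable is `disc (reflect S) z`. -/
def disc (S : Finset (ℤ × ℤ)) (z : ℝ) : ℝ[X] :=
  kernelCoeff S z 0 ^ 2 - 4 * kernelCoeff S z 1 * kernelCoeff S z (-1)

/-- The smaller one of the two roots of `d` in the open unit disc (they are real). -/
def branch₁ (d : ℝ[X]) : ℝ := sInf {t : ℝ | -1 < t ∧ t < 1 ∧ d.IsRoot t}

/-- The larger one of the two roots of `d` in the open unit disc. -/
def branch₂ (d : ℝ[X]) : ℝ := sSup {t : ℝ | -1 < t ∧ t < 1 ∧ d.IsRoot t}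

/-- The smallest root of `d` in `(1, ∞)`. -/
def branch₃ (d : ℝ[X]) : ℝ := sInf {t : ℝ | 1 < t ∧ d.IsRoot t}

open Classical in
/-- The fourth branch point: the remaining root of `d` outside the closed unit disc, which lies
in `(branch₃ d, ∞)` or in `(-∞, -1)`, or `∞` if `d` has degree three. -/
def branch₄ (d : ℝ[X]) : OnePoint ℝ :=
  if h : ∃ t : ℝ, 1 < |t| ∧ t ≠ branch₃ d ∧ d.IsRoot t then ((h.choose : ℝ) : OnePoint ℝ) else ∞

/-! ### Periods -/

/-- `ω₁ = i ∫_{x₁}^{x₂} dx / √(-d(x))`. -/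
def omega₁ (S : Finset (ℤ × ℤ)) (z : ℝ) : ℂ :=
  Complex.I * ((∫ t in (branch₁ (disc S z))..(branch₂ (disc S z)),
    1 / √(-(disc S z).eval t) : ℝ) : ℂ)

/-- `ω₂ = ∫_{x₂}^{x₃} dx / √(d(x))`. -/
def omega₂ (S : Finset (ℤ × ℤ)) (z : ℝ) : ℝ :=
  ∫ t in (branch₂ (disc S z))..(branch₃ (disc S z)), 1 / √((disc S z).eval t)

/-- `X(y)` at a branch point `y`: the double root `-b̃(y) / (2 ã(y))` of
`K(x, y) = ã(y) x² + b̃(y) x + c̃(y)`, which is `∞` if `ã(y) = 0`. -/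
def doubleRoot (S : Finset (ℤ × ℤ)) (z : ℝ) (y : ℝ) : OnePoint ℝ :=
  if (kernelCoeff (reflect S) z 1).eval y = 0 then ∞
  else ((-(kernelCoeff (reflect S) z 0).eval y / (2 * (kernelCoeff (reflect S) z 1).eval y) : ℝ) :
    OnePoint ℝ)

/-- `ω₃ = ∫_{X(y₁)}^{x₁} dx / √(d(x))`; if `X(y₁) = ∞`, the integral is over `(-∞, x₁]`. -/
def omega₃ (S : Finset (ℤ × ℤ)) (z : ℝ) : ℝ :=
  match doubleRoot S z (branch₁ (disc (reflect S) z)) with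
  | ∞ => ∫ t in Set.Iic (branch₁ (disc S z)), 1 / √((disc S z).eval t)
  | OnePoint.some X₁ => ∫ t in X₁..(branch₁ (disc S z)), 1 / √((disc S z).eval t)

/-- `ω_{y₂} = (ω₁ + ω₂ + ω₃) / 2`. -/
def omegaY₂ (S : Finset (ℤ × ℤ)) (z : ℝ) : ℂ :=
  (omega₁ S z + (omega₂ S z : ℂ) + (omega₃ S z : ℂ)) / 2

/-! ### Uniformization -/

open Classical in
/-- The Weierstrass function `℘(u; w₁, w₂)` with values in the Riemann sphere. (If `w₁`, `w₂` are
linearly dependent over `ℝ`, there is no such function and the value is meaningless.) -/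
def wp (w₁ w₂ u : ℂ) : OnePoint ℂ :=
  if h : LinearIndependent ℝ ![w₁, w₂] then
    if u ∈ (PeriodPair.mk w₁ w₂ h).lattice then ∞
    else ((PeriodPair.weierstrassP ⟨w₁, w₂, h⟩ u : ℂ) : OnePoint ℂ)
  else ∞

/-- The inverse `g⁻¹`, on the Riemann sphere, of the Möbius transformation
`g(t) = d''(t₄) / 6 + d'(t₄) / (t - t₄)` if `t₄ ≠ ∞`, and of the affine map
`g(t) = d''(0) / 6 + d'''(0) t / 6` if `t₄ = ∞`; here `t₄` is the fourth branch point. -/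
def gInv (d : ℝ[X]) : OnePoint ℂ → OnePoint ℂ :=
  match branch₄ d with
  | OnePoint.some t₄ => fun p => match p with
    | ∞ => ((t₄ : ℂ) : OnePoint ℂ)
    | OnePoint.some p =>
      open Classical in
      if p = (((derivative^[2] d).eval t₄ / 6 : ℝ) : ℂ) then ∞
      else (((t₄ : ℂ) + ((derivative d).eval t₄ : ℝ) /
        (p - (((derivative^[2] d).eval t₄ / 6 : ℝ) : ℂ)) : ℂ) : OnePoint ℂ)
  | ∞ => fun p => match p with
    | ∞ => ∞
    | OnePoint.some p =>
      (((6 * p - ((derivative^[2] d).eval 0 : ℝ)) / ((derivative^[3] d).eval 0 : ℝ) : ℂ) :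
        OnePoint ℂ)

/-- The coordinate `y(ω) = g_y⁻¹(℘(ω - ω₃ / 2))` of the uniformization of the kernel curve. -/
def yCoord (S : Finset (ℤ × ℤ)) (z : ℝ) (ω : ℂ) : OnePoint ℂ :=
  gInv (disc (reflect S) z) (wp (omega₁ S z) (omega₂ S z) (ω - (omega₃ S z : ℂ) / 2))

/-- The curvilinear strip `Δ_y`: the part of `{|y(ω)| < 1}` inside the vertical strip of width
`ω₂` centered around the line `Re ω = Re ω_{y₂}`. -/
def deltaY (S : Finset (ℤ × ℤ)) (z : ℝ) : Set ℂ :=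
  {ω | omega₃ S z / 2 ≤ ω.re ∧ ω.re < omega₃ S z / 2 + omega₂ S z ∧
    ∃ v : ℂ, yCoord S z ω = (v : OnePoint ℂ) ∧ ‖v‖ < 1}

/-! ### Poles, Laurent coefficients and principal parts -/

/-- `d` is a pole of `g`. -/
def IsPole (g : ℂ → ℂ) (d : ℂ) : Prop := meromorphicOrderAt g d < 0

/-- The coefficient `g_k` of the Laurent expansion `∑ g_k (ω - d) ^ k` of `g` at `d`: if `p` is the
order of `g` at `d`, it is the Taylor coefficient of degree `k - p` of the function
`(ω - d) ^ (-p) * g`, which extends holomorphically to `d`. -/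
def laurentCoeff (g : ℂ → ℂ) (d : ℂ) (k : ℤ) : ℂ :=
  let p : ℤ := (meromorphicOrderAt g d).untop₀
  if k < p then 0
  else iteratedDeriv (k - p).toNat
      (toMeromorphicNFAt (fun ζ => (ζ - d) ^ (-p) * g ζ) d) d / ((k - p).toNat.factorial : ℂ)

/-- The principal part `∑_{k < 0} g_k (ω - d) ^ k` of `g` at `d` (with Lean's convention
`0 ^ k = 0` for `k < 0`, its value at `ω = d` is `0`). -/
def principalPart (g : ℂ → ℂ) (d ω : ℂ) : ℂ :=
  ∑ k ∈ Finset.Ico ((meromorphicOrderAt g d).untop₀) 0, laurentCoeff g d k * (ω - d) ^ k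

/-! ### The function `r_y` -/

/-- `r` is the function `r_y`: the meromorphic continuation to `ℂ` of
`ω ↦ K(0, y(ω)) Q(0, y(ω))`, `ω ∈ Δ_y`. The second clause fixes the values of the function: by
it `r` is continuous wherever it has no pole, and its value at a pole is, by convention, the
constant coefficient of the Laurent expansion there. -/
structure IsRy (S : Finset (ℤ × ℤ)) (z : ℝ) (r : ℂ → ℂ) : Prop where
  meromorphic : ∀ ω, MeromorphicAt r ω
  value : ∀ ω, r ω = laurentCoeff r ω 0
  eq_on_deltaY : ∀ ω ∈ deltaY S z, ∀ v : ℂ, yCoord S z ω = (v : OnePoint ℂ) →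
    r ω = kernel S z 0 v * genFun S z 0 v

/-! ### Parallelograms -/

/-- `P` is a (closed, nondegenerate) parallelogram centered at `c`. -/
def IsParallelogramCenteredAt (c : ℂ) (P : Set ℂ) : Prop :=
  ∃ u v : ℂ, LinearIndependent ℝ ![u, v] ∧
    P = {w | ∃ s ∈ Set.Icc (-1 : ℝ) 1, ∃ t ∈ Set.Icc (-1 : ℝ) 1, w = c + s * u + t * v}

end QuarterPlane

end

/-! Write c for ω_{y₂} and w = ω − c. Applying the residue theorem on P_m to r(ζ)(1/(ζ−ω) − 1/(ζ−c))
produces, up to the factor ∮ dζ/(ζ−c), the difference between r(ω) − r(c) and the m-th sum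
(`boxIntegral_meromorphic_mul_inv_sub`). It remains to show that this integral tends to 0. The
bracket decays only like |ζ−c|⁻² while r is of size m, so a direct estimate gives no decay, and the
perimeter of P_m is not controlled either.

The missing order comes from a symmetry: r(2c − ζ) = r(ζ) (`IsRy.eventually_reflect`). Pairing
opposite edges of the centred parallelogram then leaves only the odd part of the bracket, 2w²/(x(x²
− w²)) with x = ζ − c, counted once per pair. It decays like |x|⁻³, and its integral along an edge
at distance at least h from c is O(h⁻²) whatever the length of the edge (`norm_edgeIntegral_le`).
With a bound C₁m on r and h = C₂m the whole integral is O(1/m) (`norm_boxIntegral_even_le`).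

The symmetry holds because c − ω₃/2 is a half-period of ℘, so y(ω) is even about c; the defining
identity on Δ_y and the identity theorem carry this over to r. This needs a nonempty open part of
Δ_y whose reflection also lies in Δ_y (`exists_open_subset_deltaY`), hence genuine periods and an
invertible g_y. That is why the four branch points are located first (`exists_rootData_disc`): they
give ω₁ ∈ iℝ nonzero, ω₂ > 0, and y₄ a simple root or, at infinity, degree exactly three. -/

noncomputable section

namespace QuarterPlane

/-! ### Roots of the discriminant -/

/-- The discriminant of a quadratic polynomial whose coefficients are quadratic polynomials. -/
def quarticEval (a₀ a₁ a₂ b₀ b₂ c₀ c₁ c₂ x : ℝ) : ℝ :=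
  (b₀ - x + b₂ * x ^ 2) ^ 2 - 4 * (a₀ + a₁ * x + a₂ * x ^ 2) * (c₀ + c₁ * x + c₂ * x ^ 2)

lemma continuous_quarticEval (a₀ a₁ a₂ b₀ b₂ c₀ c₁ c₂ : ℝ) :
    Continuous (quarticEval a₀ a₁ a₂ b₀ b₂ c₀ c₁ c₂) := by
  unfold quarticEval; fun_prop

/-- With A, C the outer coefficients at 1, the hypothesis on the sum gives A + C < 1 − b₀ − b₂, and
4AC ≤ (A + C)². -/
lemma quarticEval_one_pos {a₀ a₁ a₂ b₀ b₂ c₀ c₁ c₂ : ℝ} (ha₀ : 0 ≤ a₀) (ha₁ : 0 ≤ a₁)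
    (ha₂ : 0 ≤ a₂) (hc₀ : 0 ≤ c₀) (hc₁ : 0 ≤ c₁) (hc₂ : 0 ≤ c₂)
    (hsum : a₀ + a₁ + a₂ + b₀ + b₂ + c₀ + c₁ + c₂ < 1) :
    0 < quarticEval a₀ a₁ a₂ b₀ b₂ c₀ c₁ c₂ 1 := by
  unfold quarticEval
  have h : (a₀ + a₁ + a₂) + (c₀ + c₁ + c₂) < 1 - b₀ - b₂ := by linarith
  have h' : ((a₀ + a₁ + a₂) + (c₀ + c₁ + c₂)) ^ 2 < (1 - b₀ - b₂) ^ 2 := by gcongr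
  nlinarith [sq_nonneg ((a₀ + a₁ + a₂) - (c₀ + c₁ + c₂))]

lemma quarticEval_neg_one_pos {a₀ a₁ a₂ b₀ b₂ c₀ c₁ c₂ : ℝ} (ha₀ : 0 ≤ a₀) (ha₁ : 0 ≤ a₁)
    (ha₂ : 0 ≤ a₂) (hb₀ : 0 ≤ b₀) (hb₂ : 0 ≤ b₂) (hc₀ : 0 ≤ c₀) (hc₁ : 0 ≤ c₁) (hc₂ : 0 ≤ c₂)
    (hsum : a₀ + a₁ + a₂ + b₀ + b₂ + c₀ + c₁ + c₂ < 1) :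
    0 < quarticEval a₀ a₁ a₂ b₀ b₂ c₀ c₁ c₂ (-1) := by
  unfold quarticEval
  have h : |(a₀ - a₁ + a₂) + (c₀ - c₁ + c₂)| < 1 + b₀ + b₂ := by
    rw [abs_lt]; constructor <;> linarith
  have h' : ((a₀ - a₁ + a₂) + (c₀ - c₁ + c₂)) ^ 2 < (1 + b₀ + b₂) ^ 2 := by
    rw [← sq_abs]; gcongr
  nlinarith [sq_nonneg ((a₀ - a₁ + a₂) - (c₀ - c₁ + c₂))]

lemma exists_roots_of_neg {f : ℝ → ℝ} (hf : Continuous f) {ρ : ℝ} (h0 : 0 ≤ ρ) (h1 : ρ < 1)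
    (hρ : f ρ < 0) (hp : 0 < f 1) (hn : 0 < f (-1)) :
    ∃ s t : ℝ, -1 < s ∧ s < t ∧ 0 < t ∧ t < 1 ∧ f s = 0 ∧ f t = 0 := by
  obtain ⟨s, hs, hs'⟩ := intermediate_value_Ioo' (by linarith : (-1 : ℝ) ≤ ρ) hf.continuousOn
    (show (0 : ℝ) ∈ Set.Ioo (f ρ) (f (-1)) from ⟨hρ, hn⟩)
  obtain ⟨t, ht, ht'⟩ := intermediate_value_Ioo h1.le hf.continuousOn
    (show (0 : ℝ) ∈ Set.Ioo (f ρ) (f 1) from ⟨hρ, hp⟩)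
  exact ⟨s, t, hs.1, hs.2.trans ht.1, h0.trans_lt ht.1, ht.2, hs', ht'⟩

/-- Here 0 is itself a root. Dividing by x leaves a cubic that is negative at 0 and positive at 1,
which yields the second root. -/
lemma exists_roots_of_zero {a₀ a₁ a₂ b₂ c₁ c₂ : ℝ} (ha₀ : 0 < a₀) (hc₁ : 0 < c₁)
    (h1 : 0 < quarticEval a₀ a₁ a₂ 0 b₂ 0 c₁ c₂ 1) :
    ∃ s t : ℝ, -1 < s ∧ s < t ∧ 0 < t ∧ t < 1 ∧ quarticEval a₀ a₁ a₂ 0 b₂ 0 c₁ c₂ s = 0 ∧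
      quarticEval a₀ a₁ a₂ 0 b₂ 0 c₁ c₂ t = 0 := by
  let f : ℝ → ℝ := fun x => x * (1 - b₂ * x) ^ 2 - 4 * (a₀ + a₁ * x + a₂ * x ^ 2) * (c₁ + c₂ * x)
  have hf : Continuous f := by fun_prop
  have hfx : ∀ x, quarticEval a₀ a₁ a₂ 0 b₂ 0 c₁ c₂ x = x * f x := fun x => by
    simp only [quarticEval, f]; ring
  have h0 : f 0 < 0 := by simp only [f]; nlinarith [mul_pos ha₀ hc₁]
  have h1' : 0 < f 1 := by rwa [hfx, one_mul] at h1
  obtain ⟨t, ht, ht'⟩ := intermediate_value_Ioo zero_le_one hf.continuousOn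
    (show (0 : ℝ) ∈ Set.Ioo (f 0) (f 1) from ⟨h0, h1'⟩)
  exact ⟨0, t, by norm_num, ht.1, ht.1, ht.2, by rw [hfx, zero_mul], by rw [hfx, ht', mul_zero]⟩

/-- The discriminant is positive at ±1 and equals −4ac where the middle coefficient vanishes. If b₀
> 0 that happens inside (0, 1), with a, c > 0; if b₀ = 0 it happens at 0. When a₀c₀ = 0 as well, the
last three hypotheses keep 0 a simple root with another root to its right. -/
lemma exists_roots_quarticEval {a₀ a₁ a₂ b₀ b₂ c₀ c₁ c₂ : ℝ} (ha₀ : 0 ≤ a₀) (ha₁ : 0 ≤ a₁)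
    (ha₂ : 0 ≤ a₂) (hb₀ : 0 ≤ b₀) (hb₂ : 0 ≤ b₂) (hc₀ : 0 ≤ c₀) (hc₁ : 0 ≤ c₁) (hc₂ : 0 ≤ c₂)
    (hsum : a₀ + a₁ + a₂ + b₀ + b₂ + c₀ + c₁ + c₂ < 1)
    (ha : 0 < a₀ + a₁ + a₂) (hc : 0 < c₀ + c₁ + c₂) (hleft : 0 < a₀ + b₀ + c₀)
    (hdiag : 0 < b₀ + c₀ + c₁) (hdiag' : 0 < b₀ + a₀ + a₁) :
    ∃ s t : ℝ, -1 < s ∧ s < t ∧ 0 < t ∧ t < 1 ∧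
      quarticEval a₀ a₁ a₂ b₀ b₂ c₀ c₁ c₂ s = 0 ∧ quarticEval a₀ a₁ a₂ b₀ b₂ c₀ c₁ c₂ t = 0 := by
  have h1 := quarticEval_one_pos ha₀ ha₁ ha₂ hc₀ hc₁ hc₂ hsum
  have hn := quarticEval_neg_one_pos ha₀ ha₁ ha₂ hb₀ hb₂ hc₀ hc₁ hc₂ hsum
  have hcont := continuous_quarticEval a₀ a₁ a₂ b₀ b₂ c₀ c₁ c₂
  rcases hb₀.lt_or_eq with hb | rfl
  · have hB : Continuous fun x : ℝ => b₀ - x + b₂ * x ^ 2 := by fun_prop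
    obtain ⟨ρ, hρ, hρ0⟩ := intermediate_value_Ioo' zero_le_one hB.continuousOn
      (show (0 : ℝ) ∈ Set.Ioo _ _ from ⟨by norm_num; linarith, by norm_num; exact hb⟩)
    refine exists_roots_of_neg hcont hρ.1.le hρ.2 ?_ h1 hn
    -- The value is at least (p + q + r)ρ², since ρ² ≤ ρ ≤ 1.
    have hpos : ∀ {p q r : ℝ}, 0 ≤ p → 0 ≤ q → 0 ≤ r → 0 < p + q + r →
        0 < p + q * ρ + r * ρ ^ 2 := fun {p q r} hp hq hr hs => by
      have h2 : 0 < ρ ^ 2 := pow_pos hρ.1 2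
      have h3 : ρ ^ 2 ≤ ρ := by nlinarith [hρ.1, hρ.2]
      nlinarith [mul_pos hs h2, mul_nonneg hp (by nlinarith [hρ.2] : 0 ≤ 1 - ρ ^ 2),
        mul_nonneg hq (by linarith : 0 ≤ ρ - ρ ^ 2)]
    simp only at hρ0
    unfold quarticEval
    rw [hρ0]
    nlinarith [mul_pos (hpos ha₀ ha₁ ha₂ ha) (hpos hc₀ hc₁ hc₂ hc)]
  · rcases hc₀.lt_or_eq with hc' | rfl
    · rcases ha₀.lt_or_eq with ha' | rfl
      · refine exists_roots_of_neg hcont le_rfl zero_lt_one ?_ h1 hn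
        unfold quarticEval
        nlinarith [mul_pos hc' ha']
      · have hcomm : ∀ x, quarticEval 0 a₁ a₂ 0 b₂ c₀ c₁ c₂ x =
            quarticEval c₀ c₁ c₂ 0 b₂ 0 a₁ a₂ x := fun x => by unfold quarticEval; ring
        simp only [hcomm] at h1 ⊢
        exact exists_roots_of_zero hc' (by linarith) h1
    · exact exists_roots_of_zero (by linarith) (by linarith) h1

/-- A polynomial of degree at most four with two roots in `(-1, 1)`, whose reversed polynomial has
two roots in `(-1, 1)` as well. -/
lemma quartic_factor {k₀ k₁ k₂ k₃ k₄ s t s' t' : ℝ} (hs : -1 < s) (hst : s < t) (ht : t < 1)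
    (hs' : -1 < s') (hst' : s' < t') (ht' : t' < 1)
    (es : k₀ + k₁ * s + k₂ * s ^ 2 + k₃ * s ^ 3 + k₄ * s ^ 4 = 0)
    (et : k₀ + k₁ * t + k₂ * t ^ 2 + k₃ * t ^ 3 + k₄ * t ^ 4 = 0)
    (es' : k₄ + k₃ * s' + k₂ * s' ^ 2 + k₁ * s' ^ 3 + k₀ * s' ^ 4 = 0)
    (et' : k₄ + k₃ * t' + k₂ * t' ^ 2 + k₁ * t' ^ 3 + k₀ * t' ^ 4 = 0) :
    ∃ κ : ℝ, ∀ x : ℝ, k₀ + k₁ * x + k₂ * x ^ 2 + k₃ * x ^ 3 + k₄ * x ^ 4 =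
      κ * (x - s) * (x - t) * (1 - t' * x) * (1 - s' * x) := by
  -- The quotient by (x − s)(x − t) is k₄x² + q₁x + q₀. The reversed polynomial is then (1 − sy)(1 −
  -- ty) times the reversed quotient, and the first two factors do not vanish for |y| < 1.
  set q₁ := k₃ + (s + t) * k₄ with hq₁
  set q₀ := k₂ + (s + t) * q₁ - s * t * k₄ with hq₀
  have hne : t - s ≠ 0 := sub_ne_zero.2 hst.ne'
  have e₁ : k₁ = s * t * q₁ * (-1) * (-1) - (s + t) * q₀ := by
    apply mul_left_cancel₀ hne
    rw [hq₀, hq₁]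
    linear_combination et - es
  have e₀ : k₀ = s * t * q₀ := by
    rw [e₁] at es
    rw [hq₀, hq₁] at es ⊢
    linear_combination es
  have e₂ : k₂ = q₀ - (s + t) * q₁ + s * t * k₄ := by rw [hq₀]; ring
  have e₃ : k₃ = q₁ - (s + t) * k₄ := by rw [hq₁]; ring
  clear_value q₀ q₁
  have hq : ∀ y : ℝ, -1 < y → y < 1 →
      k₄ + k₃ * y + k₂ * y ^ 2 + k₁ * y ^ 3 + k₀ * y ^ 4 = 0 → k₄ + q₁ * y + q₀ * y ^ 2 = 0 := by
    intro y hy hy' e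
    have h1 : (1 - s * y) * (1 - t * y) ≠ 0 := by
      apply mul_ne_zero <;> nlinarith
    apply mul_left_cancel₀ h1
    rw [e₀, e₁, e₂, e₃] at e
    linear_combination e
  have hqs := hq s' hs' (hst'.trans ht') es'
  have hqt := hq t' (hs'.trans hst') ht' et'
  have hne' : t' - s' ≠ 0 := sub_ne_zero.2 hst'.ne'
  have f₁ : q₁ = -(s' + t') * q₀ := by
    apply mul_left_cancel₀ hne'
    linear_combination hqt - hqs
  have f₀ : k₄ = s' * t' * q₀ := by
    rw [f₁] at hqs
    linear_combination hqs
  refine ⟨q₀, fun x => ?_⟩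
  rw [e₀, e₁, e₂, e₃, f₁, f₀]
  ring

/-! ### The discriminant of a non-singular step set -/

/-- The indicator of `(i, j) ∈ S`. -/
def stepInd (S : Finset (ℤ × ℤ)) (i j : ℤ) : ℝ := if (i, j) ∈ S then 1 else 0

lemma stepInd_nonneg (S : Finset (ℤ × ℤ)) (i j : ℤ) : 0 ≤ stepInd S i j := by
  unfold stepInd; split_ifs <;> norm_num

lemma stepInd_eq_one {S : Finset (ℤ × ℤ)} {i j : ℤ} (h : (i, j) ∈ S) : stepInd S i j = 1 :=
  if_pos h

lemma stepInd_zero_zero {S : Finset (ℤ × ℤ)} (hS : IsSmallStepSet S) : stepInd S 0 0 = 0 :=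
  if_neg fun h => (hS _ h).2.2 rfl

lemma IsSmallStepSet.cases {S : Finset (ℤ × ℤ)} (hS : IsSmallStepSet S) {s : ℤ × ℤ} (hs : s ∈ S) :
    (s.1 = -1 ∨ s.1 = 0 ∨ s.1 = 1) ∧ (s.2 = -1 ∨ s.2 = 0 ∨ s.2 = 1) := by
  obtain ⟨⟨h1, h2⟩, ⟨h3, h4⟩, -⟩ := hS s hs
  omega

lemma sum_filter_eq {S : Finset (ℤ × ℤ)} (hS : IsSmallStepSet S) {M : Type*} [AddCommMonoid M]
    (f : ℤ → M) (j : ℤ) :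
    ∑ s ∈ S with s.2 = j, f s.1 =
      (if (-1, j) ∈ S then f (-1) else 0) + (if (0, j) ∈ S then f 0 else 0) +
        (if (1, j) ∈ S then f 1 else 0) := by
  have : ∑ s ∈ S with s.2 = j, f s.1 =
      ∑ i ∈ ({-1, 0, 1} : Finset ℤ) with (i, j) ∈ S, f i := by
    refine Finset.sum_bij (fun s _ => s.1) ?_ ?_ ?_ (fun _ _ => rfl)
    · rintro ⟨a, b⟩ hs
      simp only [Finset.mem_filter] at hs
      obtain ⟨hs, rfl⟩ := hs
      have := (hS.cases hs).1
      simp only [Finset.mem_filter, Finset.mem_insert, Finset.mem_singleton]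
      exact ⟨this, hs⟩
    · rintro ⟨a, b⟩ hs ⟨a', b'⟩ hs' h
      simp only [Finset.mem_filter] at hs hs'
      ext
      · exact h
      · exact hs.2.trans hs'.2.symm
    · intro i hi
      simp only [Finset.mem_filter] at hi
      exact ⟨(i, j), by simp [hi.2], rfl⟩
  rw [this, Finset.sum_filter, Finset.sum_insert (by decide), Finset.sum_insert (by decide),
    Finset.sum_singleton, add_assoc]

lemma kernelCoeff_eq {S : Finset (ℤ × ℤ)} (hS : IsSmallStepSet S) (z : ℝ) (j : ℤ) :
    kernelCoeff S z j = C (z * stepInd S (-1) j) + C (z * stepInd S 0 j) * X +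
      C (z * stepInd S 1 j) * X ^ 2 - if j = 0 then X else 0 := by
  unfold kernelCoeff
  rw [sum_filter_eq hS (fun i => C z * X ^ (i + 1).toNat)]
  congr 1
  unfold stepInd
  congr 1
  · congr 1 <;> split_ifs <;> simp
  · split_ifs <;> simp

lemma card_eq_sum_stepInd {S : Finset (ℤ × ℤ)} (hS : IsSmallStepSet S) :
    (S.card : ℝ) = stepInd S (-1) 1 + stepInd S 0 1 + stepInd S 1 1 + stepInd S (-1) 0 +
      stepInd S 1 0 + stepInd S (-1) (-1) + stepInd S 0 (-1) + stepInd S 1 (-1) := by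
  have h : (S.card : ℝ) = ∑ j ∈ ({-1, 0, 1} : Finset ℤ), ∑ s ∈ S with s.2 = j, (1 : ℝ) := by
    rw [Finset.sum_fiberwise_of_maps_to]
    · simp
    · intro s hs
      have := (hS.cases hs).2
      simpa using this
  have h0 := stepInd_zero_zero hS
  rw [h, Finset.sum_insert (by decide), Finset.sum_insert (by decide), Finset.sum_singleton,
    sum_filter_eq hS (fun _ => (1 : ℝ)), sum_filter_eq hS (fun _ => (1 : ℝ)),
    sum_filter_eq hS (fun _ => (1 : ℝ))]
  simp only [stepInd] at h0 ⊢
  rw [h0]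
  ring

lemma eval_disc {S : Finset (ℤ × ℤ)} (hS : IsSmallStepSet S) (z x : ℝ) :
    (disc S z).eval x = quarticEval (z * stepInd S (-1) 1) (z * stepInd S 0 1) (z * stepInd S 1 1)
      (z * stepInd S (-1) 0) (z * stepInd S 1 0) (z * stepInd S (-1) (-1)) (z * stepInd S 0 (-1))
      (z * stepInd S 1 (-1)) x := by
  unfold disc quarticEval
  rw [kernelCoeff_eq hS, kernelCoeff_eq hS, kernelCoeff_eq hS, stepInd_zero_zero hS]
  simp
  ring

/-- The position of the roots of the discriminant, with `1 / t'` and `1 / s'` the roots outside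
the unit disc (the latter one at infinity if `s' = 0`). -/
structure RootData (d : ℝ[X]) (κ s t s' t' : ℝ) : Prop where
  κ_pos : 0 < κ
  neg_one_lt : -1 < s
  lt : s < t
  pos : 0 < t
  lt_one : t < 1
  neg_one_lt' : -1 < s'
  lt' : s' < t'
  pos' : 0 < t'
  lt_one' : t' < 1
  eq : d = C κ * (X - C s) * (X - C t) * (1 - C t' * X) * (1 - C s' * X)

/-- Non-singularity in eight directions supplies the positivity needed by
`exists_roots_quarticEval`, both for d and for its reversal, whose roots are the inverses of the
outer ones. A zero root of the reversal encodes a branch point at infinity. -/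
lemma exists_rootData_disc {S : Finset (ℤ × ℤ)} (hS : IsSmallStepSet S) (hns : NonSingular S)
    {z : ℝ} (hz : z ∈ Set.Ioo (0 : ℝ) (1 / (S.card : ℝ))) :
    ∃ κ s t s' t', RootData (disc S z) κ s t s' t' := by
  have hz0 := hz.1
  have hcard : z * (S.card : ℝ) < 1 := by
    -- For empty S the convention 1 / 0 = 0 leaves no admissible z.
    have : (0 : ℝ) < S.card := by
      rcases (Nat.cast_nonneg S.card : (0 : ℝ) ≤ S.card).lt_or_eq with h | h
      · exact h
      · have := hz.2; rw [← h] at this; simp at this; linarith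
    exact (lt_div_iff₀ this).1 hz.2
  rw [card_eq_sum_stepInd hS] at hcard
  have nn := fun i j => mul_nonneg hz0.le (stepInd_nonneg S i j)
  have key : ∀ a b : ℤ, (a, b) ≠ (0, 0) → ∃ s ∈ S, a * s.1 + b * s.2 < 0 := by
    intro a b hab
    obtain ⟨s, hs, h⟩ := hns a b (by simpa [Prod.ext_iff] using hab)
    exact ⟨s, hs, by exact_mod_cast h⟩
  have sum_pos : ∀ p q r : ℤ × ℤ, (p ∈ S ∨ q ∈ S ∨ r ∈ S) →
      0 < z * stepInd S p.1 p.2 + z * stepInd S q.1 q.2 + z * stepInd S r.1 r.2 := by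
    intro p q r h
    have hp := nn p.1 p.2
    have hq := nn q.1 q.2
    have hr := nn r.1 r.2
    rcases h with h | h | h <;> have e := stepInd_eq_one (S := S) h <;>
      rw [e, mul_one] at * <;> linarith
  -- In each direction used below, exactly three of the eight small steps lie strictly on the
  -- negative side.
  have tri : ∀ (a b : ℤ) (p q r : ℤ × ℤ), (a, b) ≠ (0, 0) →
      (∀ s : ℤ × ℤ, (s.1 = -1 ∨ s.1 = 0 ∨ s.1 = 1) → (s.2 = -1 ∨ s.2 = 0 ∨ s.2 = 1) →
        a * s.1 + b * s.2 < 0 → s = p ∨ s = q ∨ s = r) →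
      0 < z * stepInd S p.1 p.2 + z * stepInd S q.1 q.2 + z * stepInd S r.1 r.2 := by
    intro a b p q r hab h
    obtain ⟨s, hs, hlt⟩ := key a b hab
    have hc := hS.cases hs
    apply sum_pos
    rcases h s hc.1 hc.2 hlt with rfl | rfl | rfl <;> simp [hs]
  have up := tri 0 (-1) (-1, 1) (0, 1) (1, 1) (by decide) (by
    rintro ⟨i, j⟩ h1 h2 h; simp only [Prod.mk.injEq] at *; omega)
  have down := tri 0 1 (-1, -1) (0, -1) (1, -1) (by decide) (by
    rintro ⟨i, j⟩ h1 h2 h; simp only [Prod.mk.injEq] at *; omega)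
  have left := tri 1 0 (-1, 1) (-1, 0) (-1, -1) (by decide) (by
    rintro ⟨i, j⟩ h1 h2 h; simp only [Prod.mk.injEq] at *; omega)
  have right := tri (-1) 0 (1, 1) (1, 0) (1, -1) (by decide) (by
    rintro ⟨i, j⟩ h1 h2 h; simp only [Prod.mk.injEq] at *; omega)
  have sw := tri 1 1 (-1, 0) (-1, -1) (0, -1) (by decide) (by
    rintro ⟨i, j⟩ h1 h2 h; simp only [Prod.mk.injEq] at *; omega)
  have nw := tri 1 (-1) (-1, 0) (-1, 1) (0, 1) (by decide) (by
    rintro ⟨i, j⟩ h1 h2 h; simp only [Prod.mk.injEq] at *; omega)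
  have se := tri (-1) 1 (1, 0) (1, -1) (0, -1) (by decide) (by
    rintro ⟨i, j⟩ h1 h2 h; simp only [Prod.mk.injEq] at *; omega)
  have ne := tri (-1) (-1) (1, 0) (1, 1) (0, 1) (by decide) (by
    rintro ⟨i, j⟩ h1 h2 h; simp only [Prod.mk.injEq] at *; omega)
  simp only at up down left right sw nw se ne
  obtain ⟨s, t, hs, hst, ht0, ht, es, et⟩ := exists_roots_quarticEval (nn (-1) 1) (nn 0 1) (nn 1 1)
    (nn (-1) 0) (nn 1 0) (nn (-1) (-1)) (nn 0 (-1)) (nn 1 (-1)) (by linarith) up down left sw nw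
  -- Mirroring the steps by (i, j) ↦ (−i, j) exchanges the coefficients of x⁰ and x², which reverses
  -- the quartic.
  obtain ⟨s', t', hs', hst', ht0', ht', es', et'⟩ := exists_roots_quarticEval (nn 1 1) (nn 0 1)
    (nn (-1) 1) (nn 1 0) (nn (-1) 0) (nn 1 (-1)) (nn 0 (-1)) (nn (-1) (-1)) (by linarith)
    (by linarith) (by linarith) right se ne
  have h1 := quarticEval_one_pos (b₀ := z * stepInd S (-1) 0) (b₂ := z * stepInd S 1 0)
    (nn (-1) 1) (nn 0 1) (nn 1 1) (nn (-1) (-1)) (nn 0 (-1)) (nn 1 (-1)) (by linarith)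
  rw [← eval_disc hS] at h1
  have hev := eval_disc hS z
  unfold quarticEval at es et es' et' hev
  generalize z * stepInd S (-1) 1 = a₀ at *
  generalize z * stepInd S 0 1 = a₁ at *
  generalize z * stepInd S 1 1 = a₂ at *
  generalize z * stepInd S (-1) 0 = b₀ at *
  generalize z * stepInd S 1 0 = b₂ at *
  generalize z * stepInd S (-1) (-1) = c₀ at *
  generalize z * stepInd S 0 (-1) = c₁ at *
  generalize z * stepInd S 1 (-1) = c₂ at *
  obtain ⟨κ, hκ⟩ := quartic_factor (k₀ := b₀ ^ 2 - 4 * a₀ * c₀)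
    (k₁ := -2 * b₀ - 4 * (a₀ * c₁ + a₁ * c₀))
    (k₂ := 1 + 2 * b₀ * b₂ - 4 * (a₀ * c₂ + a₁ * c₁ + a₂ * c₀))
    (k₃ := -2 * b₂ - 4 * (a₁ * c₂ + a₂ * c₁)) (k₄ := b₂ ^ 2 - 4 * a₂ * c₂) hs hst ht hs' hst' ht'
    (by linear_combination es) (by linear_combination et) (by linear_combination es')
    (by linear_combination et')
  have hfac : ∀ x, (disc S z).eval x =
      κ * (x - s) * (x - t) * (1 - t' * x) * (1 - s' * x) := fun x => by
    rw [hev, ← hκ]; ring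
  refine ⟨κ, s, t, s', t', ?_, hs, hst, ht0, ht, hs', hst', ht0', ht', ?_⟩
  · rw [hfac 1] at h1
    have : 0 < (1 - s) * (1 - t) * (1 - t' * 1) * (1 - s' * 1) := by
      have h2 : 0 < 1 - s := by linarith
      have h3 : 0 < 1 - t := by linarith
      have h4 : 0 < 1 - t' * 1 := by linarith
      have h5 : 0 < 1 - s' * 1 := by linarith
      positivity
    by_contra hk
    nlinarith
  · apply Polynomial.funext
    intro x
    rw [hfac]
    simp

/-! ### Branch points, periods and the Möbius transformation -/

namespace RootData

variable {d : ℝ[X]} {κ s t s' t' : ℝ}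

lemma eval_eq (h : RootData d κ s t s' t') (x : ℝ) :
    d.eval x = κ * (x - s) * (x - t) * (1 - t' * x) * (1 - s' * x) := by
  rw [h.eq]; simp

lemma isRoot_iff (h : RootData d κ s t s' t') (x : ℝ) :
    d.IsRoot x ↔ x = s ∨ x = t ∨ t' * x = 1 ∨ s' * x = 1 := by
  have := h.κ_pos.ne'
  rw [Polynomial.IsRoot, h.eval_eq]
  simp only [mul_eq_zero, this, false_or, sub_eq_zero, eq_comm (a := (1 : ℝ))]
  tauto

lemma setOf_inner (h : RootData d κ s t s' t') :
    {x : ℝ | -1 < x ∧ x < 1 ∧ d.IsRoot x} = {s, t} := by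
  have h1 := h.neg_one_lt; have h2 := h.lt; have h3 := h.lt_one; have h4 := h.neg_one_lt'
  have h5 := h.lt'; have h6 := h.lt_one'
  ext x
  simp only [Set.mem_ofPred_eq, h.isRoot_iff, Set.mem_insert_iff, Set.mem_singleton_iff]
  constructor
  · rintro ⟨hx, hx', h | h | h | h⟩
    · exact .inl h
    · exact .inr h
    · nlinarith
    · nlinarith
  · rintro (rfl | rfl)
    · exact ⟨h1, h2.trans h3, .inl rfl⟩
    · exact ⟨h1.trans h2, h3, .inr (.inl rfl)⟩

lemma branch₁_eq (h : RootData d κ s t s' t') : branch₁ d = s := by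
  rw [branch₁, h.setOf_inner, csInf_pair, inf_eq_left.2 h.lt.le]

lemma branch₂_eq (h : RootData d κ s t s' t') : branch₂ d = t := by
  rw [branch₂, h.setOf_inner, csSup_pair, sup_eq_right.2 h.lt.le]

lemma lt_inv (h : RootData d κ s t s' t') : 1 < t'⁻¹ := (one_lt_inv₀ h.pos').2 h.lt_one'

lemma branch₃_eq (h : RootData d κ s t s' t') : branch₃ d = t'⁻¹ := by
  have hl : IsLeast {x : ℝ | 1 < x ∧ d.IsRoot x} t'⁻¹ := by
    refine ⟨⟨h.lt_inv, (h.isRoot_iff _).2 (.inr (.inr (.inl (mul_inv_cancel₀ h.pos'.ne'))))⟩, ?_⟩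
    rintro x ⟨hx, hx'⟩
    have h2 := h.lt; have h3 := h.lt_one; have h5 := h.lt'
    have := h.pos'
    rw [inv_le_iff_one_le_mul₀' h.pos']
    rcases (h.isRoot_iff x).1 hx' with h | h | h | h
    · linarith
    · linarith
    · exact h.ge
    · nlinarith
  exact hl.csInf_eq

-- The choice in `branch₄` is harmless: once 1/t' is excluded, 1/s' is the only root outside the
-- closed unit disc.
open Classical in
lemma branch₄_eq_of_ne (h : RootData d κ s t s' t') (hs : s' ≠ 0) :
    branch₄ d = ((s'⁻¹ : ℝ) : OnePoint ℝ) := by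
  have h1 := h.neg_one_lt; have h2 := h.lt; have h3 := h.lt_one; have h4 := h.neg_one_lt'
  have h5 := h.lt'; have h6 := h.lt_one'
  have hex : ∃ x : ℝ, 1 < |x| ∧ x ≠ branch₃ d ∧ d.IsRoot x := by
    refine ⟨s'⁻¹, ?_, ?_, (h.isRoot_iff _).2 (.inr (.inr (.inr (mul_inv_cancel₀ hs))))⟩
    · rw [abs_inv, one_lt_inv₀ (abs_pos.2 hs), abs_lt]
      exact ⟨h4, h5.trans h6⟩
    · rw [h.branch₃_eq, Ne, inv_inj]
      exact h5.ne
  rw [branch₄, dif_pos hex]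
  congr 1
  obtain ⟨hx, hx', hx''⟩ := hex.choose_spec
  generalize hex.choose = x at hx hx' hx'' ⊢
  rw [h.branch₃_eq] at hx'
  rcases (h.isRoot_iff _).1 hx'' with e | e | e | e
  · rw [e, lt_abs] at hx; rcases hx with hx | hx <;> linarith
  · rw [e, lt_abs] at hx; rcases hx with hx | hx <;> linarith
  · exact absurd (eq_inv_of_mul_eq_one_right e) hx'
  · exact eq_inv_of_mul_eq_one_right e

open Classical in
lemma branch₄_eq_of_eq (h : RootData d κ s t s' t') (hs : s' = 0) : branch₄ d = ∞ := by
  have h1 := h.neg_one_lt; have h2 := h.lt; have h3 := h.lt_one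
  rw [branch₄, dif_neg]
  rintro ⟨x, hx, hx', hx''⟩
  rw [h.branch₃_eq] at hx'
  rcases (h.isRoot_iff _).1 hx'' with rfl | rfl | e | e
  · rw [lt_abs] at hx; rcases hx with hx | hx <;> linarith
  · rw [lt_abs] at hx; rcases hx with hx | hx <;> linarith
  · exact hx' (eq_inv_of_mul_eq_one_right e)
  · simp [hs] at e

/-- The fourth branch point is a simple root, so the Möbius map g is not constant. -/
lemma derivative_eval_ne_zero (h : RootData d κ s t s' t') (hs : s' ≠ 0) :
    (derivative d).eval s'⁻¹ ≠ 0 := by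
  have h1 := h.neg_one_lt; have h2 := h.lt; have h3 := h.lt_one; have h4 := h.neg_one_lt'
  have h5 := h.lt'; have h6 := h.lt_one'
  rw [h.eq]
  simp only [derivative_mul, derivative_C, derivative_sub, derivative_X, derivative_one, eval_add,
    eval_mul, eval_C, eval_X, eval_sub, eval_one, mul_inv_cancel₀ hs, sub_self, zero_mul, mul_zero,
    zero_add, zero_sub, sub_zero, mul_one]
  have hlt : ∀ a : ℝ, a * s' < 1 → s'⁻¹ - a ≠ 0 := fun a ha e => by
    rw [sub_eq_zero] at e
    rw [← e, inv_mul_cancel₀ hs] at ha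
    exact lt_irrefl _ ha
  have e3 : (1 - t' * s'⁻¹) ≠ 0 := by
    rw [sub_ne_zero]
    intro e
    have := (mul_inv_eq_one₀ hs).1 e.symm
    exact h5.ne' this
  have e1 := hlt s (by nlinarith)
  have e2 := hlt t (by nlinarith)
  have := h.κ_pos.ne'
  simp [*]

/-- With s' = 0 the leading coefficient is −κt' ≠ 0, so the affine map g is not constant. -/
lemma derivative_three_eval_ne_zero (h : RootData d κ s t s' t') (hs : s' = 0) :
    (derivative^[3] d).eval 0 ≠ 0 := by
  have hd : d = C (-(κ * t')) * X ^ 3 + C (κ * (1 + t' * (s + t))) * X ^ 2 +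
      C (-(κ * (s + t + t' * (s * t)))) * X + C (κ * (s * t)) := by
    apply Polynomial.funext
    intro x
    rw [h.eval_eq, hs]
    simp
    ring
  rw [hd]
  have := h.κ_pos.ne'
  have := h.pos'.ne'
  simp [Function.iterate_succ]
  norm_num
  tauto

end RootData

/-! ### Positivity of the periods -/

/-- Integrability at the square-root singularities. -/
lemma intervalIntegrable_one_div_sqrt {a b : ℝ} (hab : a < b) {p : ℝ → ℝ} (hp : Continuous p)
    (hpos : ∀ x ∈ Set.Icc a b, 0 < p x) :
    IntervalIntegrable (fun x => 1 / √((x - a) * (b - x) * p x)) MeasureTheory.volume a b := by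
  obtain ⟨x₀, hx₀, hmin⟩ := isCompact_Icc.exists_isMinOn (Set.nonempty_Icc.2 hab.le) hp.continuousOn
  set m := p x₀
  have hm : 0 < m := hpos x₀ hx₀
  have h1 : IntervalIntegrable (fun x : ℝ => (x - a) ^ (-(1 / 2) : ℝ)) MeasureTheory.volume a b := by
    have := (intervalIntegral.intervalIntegrable_rpow' (a := 0) (b := b - a)
      (show (-1 : ℝ) < -(1 / 2) by norm_num)).comp_sub_right a
    simpa using this
  have h2 : IntervalIntegrable (fun x : ℝ => (b - x) ^ (-(1 / 2) : ℝ)) MeasureTheory.volume a b := by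
    have := (intervalIntegral.intervalIntegrable_rpow' (a := b - a) (b := 0)
      (show (-1 : ℝ) < -(1 / 2) by norm_num)).comp_sub_left b
    simpa using this
  refine ((h1.add h2).const_mul (1 / √((b - a) / 2 * m))).mono_fun' ?_ ?_
  · apply Measurable.aestronglyMeasurable
    have := hp.measurable
    fun_prop
  · refine MeasureTheory.ae_restrict_of_ae_restrict_of_subset
      (t := Set.Ioc a b) (by rw [Set.uIoc_of_le hab.le]) ?_
    rw [← MeasureTheory.restrict_Ioo_eq_restrict_Ioc]
    refine (MeasureTheory.ae_restrict_mem measurableSet_Ioo).mono fun x hx => ?_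
    have hxa : 0 < x - a := sub_pos.2 hx.1
    have hxb : 0 < b - x := sub_pos.2 hx.2
    have hpm : m ≤ p x := hmin (Set.Ioo_subset_Icc_self hx)
    have hrp : ∀ y : ℝ, 0 < y → y ^ (-(1 / 2) : ℝ) = 1 / √y := fun y hy => by
      rw [Real.rpow_neg hy.le, ← Real.sqrt_eq_rpow, one_div]
    beta_reduce
    rw [Real.norm_of_nonneg (by positivity)]
    rw [hrp _ hxa, hrp _ hxb]
    have hba : 0 < b - a := sub_pos.2 hab
    -- One of x − a, b − x is at least (b − a)/2, so only one of the two singularities matters at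
    -- each point.
    have main : ∀ y w : ℝ, 0 < y → 0 < w → (b - a) / 2 ≤ w →
        1 / √(y * w * p x) ≤ 1 / √((b - a) / 2 * m) * (1 / √y) := fun y w hy hw hw' => by
      rw [one_div_mul_one_div, ← Real.sqrt_mul (by positivity)]
      apply one_div_le_one_div_of_le (by positivity)
      apply Real.sqrt_le_sqrt
      calc (b - a) / 2 * m * y ≤ w * p x * y := by gcongr
        _ = y * w * p x := by ring
    rcases le_total ((b - a) / 2) (b - x) with h | h
    · refine (main _ _ hxa hxb h).trans ?_
      gcongr
      exact le_add_of_nonneg_right (by positivity)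
    · have h' : (b - a) / 2 ≤ x - a := by linarith
      rw [mul_comm (x - a)]
      refine (main _ _ hxb hxa h').trans ?_
      gcongr
      exact le_add_of_nonneg_left (by positivity)

/-- Integrability is essential here: a non-integrable integrand would have integral 0 by convention.
-/
lemma integral_one_div_sqrt_pos {a b : ℝ} (hab : a < b) {f p : ℝ → ℝ} (hp : Continuous p)
    (hpos : ∀ x ∈ Set.Icc a b, 0 < p x) (hf : ∀ x, f x = (x - a) * (b - x) * p x) :
    0 < ∫ x in a..b, 1 / √(f x) := by
  have hf' : f = fun x => (x - a) * (b - x) * p x := funext hf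
  subst hf'
  refine intervalIntegral.intervalIntegral_pos_of_pos_on
    (intervalIntegrable_one_div_sqrt hab hp hpos) (fun x hx => ?_) hab
  have h1 : 0 < x - a := sub_pos.2 hx.1
  have h2 : 0 < b - x := sub_pos.2 hx.2
  have h3 := hpos x (Set.Ioo_subset_Icc_self hx)
  positivity

namespace RootData

variable {S : Finset (ℤ × ℤ)} {z κ s t s' t' : ℝ}

lemma omega₁_ne_zero (h : RootData (disc S z) κ s t s' t') :
    ∃ p : ℝ, p ≠ 0 ∧ omega₁ S z = Complex.I * p := by
  have h0 := h.κ_pos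
  have h1 := h.neg_one_lt; have h2 := h.lt; have h3 := h.lt_one; have h4 := h.neg_one_lt'
  have h5 := h.lt'; have h6 := h.lt_one'
  refine ⟨_, ne_of_gt ?_, rfl⟩
  rw [h.branch₁_eq, h.branch₂_eq]
  refine integral_one_div_sqrt_pos h2 (p := fun x => κ * ((1 - t' * x) * (1 - s' * x)))
    (by fun_prop) (fun x hx => ?_) (fun x => by rw [h.eval_eq]; ring)
  have e1 : 0 < 1 - t' * x := by nlinarith [hx.1, hx.2, h.pos']
  have e2 : 0 < 1 - s' * x := by nlinarith [hx.1, hx.2]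
  positivity

lemma omega₂_pos (h : RootData (disc S z) κ s t s' t') : 0 < omega₂ S z := by
  have h0 := h.κ_pos
  have h1 := h.neg_one_lt; have h2 := h.lt; have h3 := h.lt_one; have h4 := h.neg_one_lt'
  have h5 := h.lt'; have h6 := h.lt_one'
  have h7 := h.lt_inv
  have h8 := h.pos'
  have h9 := h.pos
  rw [omega₂, h.branch₂_eq, h.branch₃_eq]
  refine integral_one_div_sqrt_pos (h3.trans h7)
    (p := fun x => κ * (t' * ((x - s) * (1 - s' * x))))
    (by fun_prop) (fun x hx => ?_) (fun x => ?_)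
  · have hx0 : 0 < x := h9.trans_le hx.1
    have hx1 : t' * x ≤ 1 := by
      have := mul_le_mul_of_nonneg_left hx.2 h8.le
      rwa [mul_inv_cancel₀ h8.ne'] at this
    have e1 : 0 < x - s := by linarith [hx.1]
    have e2 : 0 < 1 - s' * x := by nlinarith
    positivity
  · rw [h.eval_eq]
    have e : 1 - t' * x = t' * (t'⁻¹ - x) := by rw [mul_sub, mul_inv_cancel₀ h8.ne']
    rw [e]; ring

end RootData

lemma linearIndependent_I_mul_ofReal {p q : ℝ} (hp : p ≠ 0) (hq : q ≠ 0) :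
    LinearIndependent ℝ ![Complex.I * p, (q : ℂ)] := by
  rw [LinearIndependent.pair_iff]
  intro a b h
  have hre := congrArg Complex.re h
  have him := congrArg Complex.im h
  simp at hre him
  tauto

lemma isSmallStepSet_reflect {S : Finset (ℤ × ℤ)} (hS : IsSmallStepSet S) :
    IsSmallStepSet (reflect S) := by
  intro s hs
  obtain ⟨w, hw, rfl⟩ := Finset.mem_image.1 hs
  obtain ⟨h1, h2, h3⟩ := hS w hw
  refine ⟨h2, h1, fun h => h3 ?_⟩
  rw [Prod.ext_iff] at h ⊢
  exact ⟨h.2, h.1⟩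

lemma nonSingular_reflect {S : Finset (ℤ × ℤ)} (hns : NonSingular S) :
    NonSingular (reflect S) := by
  intro a b hab
  obtain ⟨s, hs, h⟩ := hns b a (fun h => hab (by rw [Prod.ext_iff] at h ⊢; exact ⟨h.2, h.1⟩))
  exact ⟨s.swap, Finset.mem_image_of_mem _ hs, by simpa [add_comm] using h⟩

lemma card_reflect (S : Finset (ℤ × ℤ)) : (reflect S).card = S.card :=
  Finset.card_image_of_injective _ Prod.swap_injective

/-- `g⁻¹` maps some disc of the plane into the unit disc. -/
lemma exists_ball_gInv {d : ℝ[X]} {κ s t s' t' : ℝ} (h : RootData d κ s t s' t') :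
    ∃ (p₀ : ℂ) (ε : ℝ), 0 < ε ∧ ∀ p : ℂ, ‖p - p₀‖ < ε →
      ∃ v : ℂ, gInv d (p : OnePoint ℂ) = (v : OnePoint ℂ) ∧ ‖v‖ < 1 := by
  by_cases hs : s' = 0
  · have hb := h.branch₄_eq_of_eq hs
    have hd := h.derivative_three_eval_ne_zero hs
    unfold gInv
    rw [hb]
    simp only
    set A : ℂ := (((derivative^[2] d).eval 0 : ℝ) : ℂ)
    set B : ℂ := (((derivative^[3] d).eval 0 : ℝ) : ℂ)
    have hB : B ≠ 0 := by simpa [B] using hd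
    have hc : ContinuousAt (fun p : ℂ => (6 * p - A) / B) (A / 6) := by fun_prop
    -- The centre A / 6 is g(0), which g⁻¹ sends to 0; in the finite case below, g(0) is A − B / T.
    have hev : ∀ᶠ p in 𝓝 (A / 6), ‖(6 * p - A) / B‖ < 1 := by
      refine hc.norm.eventually_lt continuousAt_const ?_
      rw [mul_div_cancel₀ _ (by norm_num : (6 : ℂ) ≠ 0)]
      simp
    obtain ⟨ε, hε, hball⟩ := Metric.eventually_nhds_iff.1 hev
    exact ⟨A / 6, ε, hε, fun p hp => ⟨_, rfl, hball (by rwa [dist_eq_norm])⟩⟩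
  · have hb := h.branch₄_eq_of_ne hs
    have hd := h.derivative_eval_ne_zero hs
    unfold gInv
    rw [hb]
    simp only
    set A : ℂ := ((Polynomial.eval s'⁻¹ (derivative^[2] d) / 6 : ℝ) : ℂ)
    set B : ℂ := (((derivative d).eval s'⁻¹ : ℝ) : ℂ)
    have hB : B ≠ 0 := by simpa [B] using hd
    set T : ℂ := ((s'⁻¹ : ℝ) : ℂ)
    have hT : T ≠ 0 := by simpa [T] using hs
    have hne : A - B / T - A ≠ 0 := by
      rw [sub_sub_cancel_left]; exact neg_ne_zero.2 (div_ne_zero hB hT)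
    have hc : ContinuousAt (fun p : ℂ => T + B / (p - A)) (A - B / T) := by
      fun_prop (disch := exact hne)
    have hev : ∀ᶠ p in 𝓝 (A - B / T), ‖T + B / (p - A)‖ < 1 := by
      refine hc.norm.eventually_lt continuousAt_const ?_
      rw [sub_sub_cancel_left, div_neg, div_div_cancel₀ hB]
      simp
    have hev' : ∀ᶠ p in 𝓝 (A - B / T), p ≠ A :=
      eventually_ne_nhds (fun e => hne (sub_eq_zero.2 e))
    obtain ⟨ε, hε, hball⟩ := Metric.eventually_nhds_iff.1 (hev.and hev')
    refine ⟨A - B / T, ε, hε, fun p hp => ⟨T + B / (p - A), ?_, (hball (by rwa [dist_eq_norm])).1⟩⟩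
    rw [if_neg (hball (by rwa [dist_eq_norm])).2]

/-! ### The symmetry of `r_y` -/

/-- The values of the Weierstrass function are dense in the plane. -/
lemma exists_norm_weierstrassP_sub_lt (L : PeriodPair) (p₀ : ℂ) {ε : ℝ} (hε : 0 < ε) :
    ∃ u ∉ L.lattice, ‖L.weierstrassP u - p₀‖ < ε := by
  classical
  by_contra! hbig
  -- If ℘ stayed at distance ε from p₀, this F would be entire and bounded, hence constant by
  -- Liouville. It vanishes on the lattice but not at a half-period.
  let F : ℂ → ℂ := fun u => if u ∈ L.lattice then 0 else (L.weierstrassP u - p₀)⁻¹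
  have hne : ∀ u ∉ L.lattice, L.weierstrassP u - p₀ ≠ 0 := fun u hu e => by
    have := hbig u hu
    rw [e, norm_zero] at this
    linarith
  have hopen : IsOpen ((L.lattice : Set ℂ)ᶜ) := L.isClosed_lattice.isOpen_compl
  have hoff : ∀ u ∉ L.lattice, DifferentiableAt ℂ F u := fun u hu => by
    have h1 : DifferentiableAt ℂ L.weierstrassP u :=
      L.differentiableOn_weierstrassP.differentiableAt (hopen.mem_nhds hu)
    have h2 : DifferentiableAt ℂ (fun u => (L.weierstrassP u - p₀)⁻¹) u :=
      (h1.sub_const p₀).inv (hne u hu)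
    refine h2.congr_of_eventuallyEq ?_
    filter_upwards [hopen.mem_nhds hu] with w hw
    exact if_neg hw
  have hdiff : Differentiable ℂ F := fun u => by
    by_cases hu : u ∈ L.lattice
    · refine (Complex.analyticAt_of_differentiable_on_punctured_nhds_of_continuousAt
        ?_ ?_).differentiableAt
      · have hmem := L.compl_lattice_sdiff_singleton_mem_nhds u
        filter_upwards [nhdsWithin_le_nhds hmem, self_mem_nhdsWithin] with w hw hwu
        exact hoff w fun hwL => hw ⟨hwL, hwu⟩
      · have hcob : Tendsto L.weierstrassP (𝓝[≠] u) (Bornology.cobounded ℂ) :=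
          tendsto_cobounded_of_meromorphicOrderAt_neg (by
            rw [L.order_weierstrassP u hu]; decide)
        have hcob' : Tendsto (fun w => L.weierstrassP w - p₀) (𝓝[≠] u)
            (Bornology.cobounded ℂ) := by
          rw [← tendsto_norm_atTop_iff_cobounded] at hcob ⊢
          exact tendsto_atTop_mono (fun w => norm_sub_norm_le _ _)
            (tendsto_atTop_add_const_right _ (-‖p₀‖) hcob)
        have hzero := (Filter.tendsto_inv₀_cobounded.comp hcob')
        have hF : F u = 0 := if_pos hu
        rw [continuousAt_iff_punctured_nhds, hF]
        refine hzero.congr' ?_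
        have hmem := L.compl_lattice_sdiff_singleton_mem_nhds u
        filter_upwards [nhdsWithin_le_nhds hmem, self_mem_nhdsWithin] with w hw hwu
        exact (if_neg fun hwL => hw ⟨hwL, hwu⟩).symm
    · exact hoff u hu
  have hbdd : Bornology.IsBounded (Set.range F) := by
    rw [isBounded_iff_forall_norm_le]
    refine ⟨ε⁻¹, ?_⟩
    rintro _ ⟨u, rfl⟩
    by_cases hu : u ∈ L.lattice
    · simp only [F, if_pos hu, norm_zero]; positivity
    · simp only [F, if_neg hu, norm_inv]
      exact inv_anti₀ hε (hbig u hu)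
  have hu := L.ω₁_div_two_notMem_lattice
  have h := hdiff.apply_eq_apply_of_bounded hbdd (L.ω₁ / 2) 0
  simp only [F, if_neg hu, if_pos L.lattice.zero_mem] at h
  exact hne _ hu (inv_eq_zero.1 h)

lemma wp_of_notMem {w₁ w₂ u : ℂ} (h : LinearIndependent ℝ ![w₁, w₂])
    (hu : u ∉ (PeriodPair.mk w₁ w₂ h).lattice) :
    wp w₁ w₂ u = ((PeriodPair.weierstrassP ⟨w₁, w₂, h⟩ u : ℂ) : OnePoint ℂ) := by
  rw [wp, dif_pos h, if_neg hu]

/-- Evenness and periodicity of ℘. -/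
lemma wp_reflect (w₁ w₂ u : ℂ) : wp w₁ w₂ (w₁ + w₂ - u) = wp w₁ w₂ u := by
  unfold wp
  split_ifs with h h1 h2 h2
  · rfl
  · exact absurd (by simpa using sub_mem (add_mem (PeriodPair.ω₁_mem_lattice ⟨w₁, w₂, h⟩)
      (PeriodPair.ω₂_mem_lattice _)) h1) h2
  · exact absurd (sub_mem (add_mem (PeriodPair.ω₁_mem_lattice ⟨w₁, w₂, h⟩)
      (PeriodPair.ω₂_mem_lattice _)) h2) h1
  · congr 1
    have := PeriodPair.weierstrassP_add_coe ⟨w₁, w₂, h⟩ (-u)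
      ⟨w₁ + w₂, add_mem (PeriodPair.ω₁_mem_lattice ⟨w₁, w₂, h⟩) (PeriodPair.ω₂_mem_lattice _)⟩
    rw [PeriodPair.weierstrassP_neg] at this
    rw [← this]
    congr 1
    ring
  · rfl

/-- Since ω_{y₂} − ω₃/2 = (ω₁ + ω₂)/2, this is `wp_reflect` in the variable ω − ω₃/2. -/
lemma yCoord_reflect (S : Finset (ℤ × ℤ)) (z : ℝ) (ω : ℂ) :
    yCoord S z (2 * omegaY₂ S z - ω) = yCoord S z ω := by
  unfold yCoord
  rw [← wp_reflect _ _ (ω - _)]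
  congr 2
  unfold omegaY₂
  ring

/-- The condition |y| < 1 holds wherever ℘ takes values in a suitable disc, and ℘ does reach that
disc. As ω₁ is purely imaginary, the open vertical strip is symmetric about Re ω_{y₂}; only the left
edge of the half-open strip breaks the symmetry. -/
lemma exists_open_subset_deltaY {S : Finset (ℤ × ℤ)} (hS : IsSmallStepSet S)
    (hns : NonSingular S) {z : ℝ} (hz : z ∈ Set.Ioo (0 : ℝ) (1 / (S.card : ℝ))) :
    ∃ V : Set ℂ, IsOpen V ∧ V.Nonempty ∧ ∀ ω ∈ V, ω ∈ deltaY S z ∧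
      2 * omegaY₂ S z - ω ∈ deltaY S z := by
  obtain ⟨κ, s, t, s', t', hd⟩ := exists_rootData_disc hS hns hz
  obtain ⟨_, _, _, _, _, hd'⟩ := exists_rootData_disc (isSmallStepSet_reflect hS)
    (nonSingular_reflect hns) (z := z) (by rwa [card_reflect])
  obtain ⟨p, hp, hω₁⟩ := hd.omega₁_ne_zero
  have hω₂ := hd.omega₂_pos
  have hLI : LinearIndependent ℝ ![omega₁ S z, (omega₂ S z : ℂ)] := by
    rw [hω₁]; exact linearIndependent_I_mul_ofReal hp hω₂.ne'
  obtain ⟨p₀, ε, hε, hball⟩ := exists_ball_gInv hd'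
  let L : PeriodPair := ⟨omega₁ S z, omega₂ S z, hLI⟩
  let W : Set ℂ := {u | u ∉ L.lattice ∧ ‖L.weierstrassP u - p₀‖ < ε}
  have hWo : IsOpen W := by
    have hc : ContinuousOn (fun u => ‖L.weierstrassP u - p₀‖) (L.lattice : Set ℂ)ᶜ :=
      (L.differentiableOn_weierstrassP.continuousOn.sub continuousOn_const).norm
    exact hc.isOpen_inter_preimage L.isClosed_lattice.isOpen_compl isOpen_Iio
  have hy : ∀ ω : ℂ, ω - (omega₃ S z : ℂ) / 2 ∈ W →
      ∃ v : ℂ, yCoord S z ω = (v : OnePoint ℂ) ∧ ‖v‖ < 1 := fun ω hω => by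
    rw [yCoord, wp_of_notMem hLI hω.1]
    exact hball _ hω.2
  have hre : (omega₁ S z).re = 0 := by rw [hω₁]; simp
  have hcre : (2 * omegaY₂ S z).re = omega₂ S z + omega₃ S z := by
    rw [omegaY₂, mul_div_cancel₀ _ two_ne_zero]
    simp [hre]
  refine ⟨{ω | ω - (omega₃ S z : ℂ) / 2 ∈ W} ∩
    {ω | omega₃ S z / 2 < ω.re ∧ ω.re < omega₃ S z / 2 + omega₂ S z}, ?_, ?_, ?_⟩
  · refine (hWo.preimage (by fun_prop)).inter ?_
    exact (isOpen_lt continuous_const Complex.continuous_re).inter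
      (isOpen_lt Complex.continuous_re continuous_const)
  · obtain ⟨u, hu⟩ := exists_norm_weierstrassP_sub_lt L p₀ hε
    -- Translation by a multiple of ω₂ brings the real part into [0, ω₂).
    let l : L.lattice := ⟨⌊u.re / omega₂ S z⌋ • (omega₂ S z : ℂ),
      L.lattice.smul_mem _ L.ω₂_mem_lattice⟩
    set u' := u - l with hu'
    have hu'W : u' ∈ W := by
      refine ⟨fun h => hu.1 ?_, ?_⟩
      · simpa [hu'] using add_mem h l.2
      · rw [hu', L.weierstrassP_sub_coe]; exact hu.2
    have hre' : u'.re = u.re - ⌊u.re / omega₂ S z⌋ * omega₂ S z := by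
      simp [hu', l]
    have h0 : 0 ≤ u'.re := by
      rw [hre', sub_nonneg, ← le_div_iff₀ hω₂]; exact Int.floor_le _
    have h1 : u'.re < omega₂ S z := by
      have := Int.lt_floor_add_one (u.re / omega₂ S z)
      rw [div_lt_iff₀ hω₂] at this
      rw [hre']; linarith
    -- A small shift to the right leaves the edge Re = 0, whose reflection falls outside the strip.
    have hev : ∀ᶠ δ : ℝ in 𝓝[>] 0, u' + δ ∈ W := by
      have hc : ContinuousAt (fun δ : ℝ => u' + (δ : ℂ)) 0 := by fun_prop
      exact nhdsWithin_le_nhds (hc.eventually_mem (hWo.mem_nhds (by simpa using hu'W)))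
    have hev' : ∀ᶠ δ : ℝ in 𝓝[>] 0, δ < omega₂ S z - u'.re :=
      nhdsWithin_le_nhds (gt_mem_nhds (by linarith))
    obtain ⟨δ, ⟨hδ, hδ'⟩, hδ0⟩ := ((hev.and hev').and self_mem_nhdsWithin).exists
    have hδ0 : 0 < δ := hδ0
    refine ⟨u' + δ + (omega₃ S z : ℂ) / 2, ?_, ?_⟩
    · simpa using hδ
    · have : (u' + δ + (omega₃ S z : ℂ) / 2).re = u'.re + δ + omega₃ S z / 2 := by simp
      rw [Set.mem_ofPred_eq, this]
      constructor <;> linarith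
  · rintro ω ⟨hω, hω1, hω2⟩
    obtain ⟨v, hv, hv'⟩ := hy ω hω
    refine ⟨⟨hω1.le, hω2, v, hv, hv'⟩, ?_, ?_, v, (yCoord_reflect S z ω).trans hv, hv'⟩
    · rw [Complex.sub_re, hcre]; linarith
    · rw [Complex.sub_re, hcre]; linarith

/-- On the open set of `exists_open_subset_deltaY`, ζ and its reflection have the same y, so r
agrees at both. The difference thus has infinite order at one point, hence at every point of the
connected plane. -/
lemma IsRy.eventually_reflect {S : Finset (ℤ × ℤ)} (hS : IsSmallStepSet S)
    (hns : NonSingular S) {z : ℝ} (hz : z ∈ Set.Ioo (0 : ℝ) (1 / (S.card : ℝ))) {r : ℂ → ℂ}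
    (hr : IsRy S z r) (ω : ℂ) : ∀ᶠ ζ in 𝓝[≠] ω, r (2 * omegaY₂ S z - ζ) = r ζ := by
  obtain ⟨V, hVo, ⟨ω₀, hω₀⟩, hV⟩ := exists_open_subset_deltaY hS hns hz
  let F : ℂ → ℂ := fun ζ => r (2 * omegaY₂ S z - ζ) - r ζ
  have hF : MeromorphicOn F Set.univ := fun ζ _ => by
    refine MeromorphicAt.sub (f := fun ζ => r (2 * omegaY₂ S z - ζ)) ?_ (hr.meromorphic ζ)
    exact (hr.meromorphic (2 * omegaY₂ S z - ζ)).comp_analyticAt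
      (g := fun ζ => 2 * omegaY₂ S z - ζ) (by fun_prop)
  have h0 : meromorphicOrderAt F ω₀ = ⊤ := by
    rw [meromorphicOrderAt_eq_top_iff]
    refine nhdsWithin_le_nhds ?_
    filter_upwards [hVo.mem_nhds hω₀] with ζ hζ
    obtain ⟨h1, h2⟩ := hV ζ hζ
    obtain ⟨_, _, v, hv, -⟩ := id h1
    simp only [F]
    rw [hr.eq_on_deltaY ζ h1 v hv,
      hr.eq_on_deltaY _ h2 v ((yCoord_reflect S z ζ).trans hv), sub_self]
  have h1 : meromorphicOrderAt F ω = ⊤ := by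
    by_contra hne
    exact hF.meromorphicOrderAt_ne_top_of_isPreconnected isPreconnected_univ (Set.mem_univ ω)
      (Set.mem_univ ω₀) hne h0
  rw [meromorphicOrderAt_eq_top_iff] at h1
  filter_upwards [h1] with ζ hζ
  exact sub_eq_zero.1 hζ

/-! ### Laurent expansions -/

lemma analyticAt_principalPart {g : ℂ → ℂ} {d ζ : ℂ} (h : ζ ≠ d) :
    AnalyticAt ℂ (principalPart g d) ζ := by
  unfold principalPart
  refine Finset.analyticAt_fun_sum _ fun k _ => analyticAt_const.mul ?_
  exact (analyticAt_id.sub analyticAt_const).zpow (sub_ne_zero.2 h)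

lemma principalPart_self (g : ℂ → ℂ) (d : ℂ) : principalPart g d d = 0 := by
  unfold principalPart
  refine Finset.sum_eq_zero fun k hk => ?_
  rw [sub_self, zero_zpow _ (Finset.mem_Ico.1 hk).2.ne, mul_zero]

lemma principalPart_eq_zero {g : ℂ → ℂ} {d : ℂ} (h : 0 ≤ (meromorphicOrderAt g d).untop₀) (ζ : ℂ) :
    principalPart g d ζ = 0 := by
  rw [principalPart, Finset.Ico_eq_empty (by simpa using h), Finset.sum_empty]

lemma principalPart_eq_sum_range {g : ℂ → ℂ} {d : ℂ} {n : ℕ}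
    (h : (meromorphicOrderAt g d).untop₀ = -n) (ζ : ℂ) :
    principalPart g d ζ =
      ∑ i ∈ Finset.range n, laurentCoeff g d (i - n) * (ζ - d) ^ ((i : ℤ) - n) := by
  rw [principalPart, h]
  refine Finset.sum_nbij' (fun k => (k + n).toNat) (fun i => (i : ℤ) - n) ?_ ?_ ?_ ?_ ?_
  · intro k hk; simp only [Finset.mem_Ico, Finset.mem_range] at *; omega
  · intro k hk; simp only [Finset.mem_Ico, Finset.mem_range] at *; omega
  · intro k hk; simp only [Finset.mem_Ico] at *; omega
  · intro k hk; simp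
  · intro k hk
    simp only [Finset.mem_Ico] at hk
    have : ((k + n).toNat : ℤ) - n = k := by omega
    rw [this]

/-- For order p = −n ≤ 0, Taylor expansion of (ζ − d)ⁿ g to order n + 1 separates the principal
part, the constant coefficient and a multiple of ζ − d. The convention `hval` makes the difference
analytic at d itself, since the principal part takes the value 0 there. -/
lemma analyticAt_sub_principalPart {g : ℂ → ℂ} {d : ℂ} (hg : MeromorphicAt g d)
    (hval : g d = laurentCoeff g d 0) :
    AnalyticAt ℂ (fun ζ => g ζ - principalPart g d ζ) d := by
  set p : ℤ := (meromorphicOrderAt g d).untop₀ with hp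
  rcases lt_or_ge 0 p with hpos | hneg
  · simp only [principalPart_eq_zero hpos.le, sub_zero]
    have h0 : g d = 0 := by
      rw [hval, laurentCoeff, if_pos hpos]
    refine AnalyticAt.of_meromorphicOrderAt_pos ?_ h0
    cases ho : meromorphicOrderAt g d with
    | top => exact WithTop.coe_lt_top 0
    | coe m =>
      rw [hp, ho] at hpos
      exact_mod_cast hpos
  · obtain ⟨n, hn⟩ : ∃ n : ℕ, p = -n := ⟨(-p).toNat, by omega⟩
    have hpn : (meromorphicOrderAt g d).untop₀ = -n := hp.symm.trans hn
    set F : ℂ → ℂ := fun ζ => (ζ - d) ^ (-p) * g ζ with hF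
    have hzp : MeromorphicAt (fun ζ : ℂ => (ζ - d) ^ (-p)) d := by fun_prop
    have hFm : MeromorphicAt F d := hzp.mul hg
    have hφ : AnalyticAt ℂ (toMeromorphicNFAt F d) d := by
      rw [← hFm.meromorphicOrderAt_nonneg_iff_analyticAt_toMeromorphicNFAt, hF]
      rw [fun_meromorphicOrderAt_mul hzp hg, fun_meromorphicOrderAt_zpow_id_sub_const]
      cases ho : meromorphicOrderAt g d with
      | top => simp
      | coe m =>
        rw [hp, ho]
        norm_cast
        simp
    set φ := toMeromorphicNFAt F d with hφdef
    have hshift : AnalyticAt ℂ (fun w => φ (d + w)) 0 := by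
      refine AnalyticAt.fun_comp (g := φ) (f := fun w => d + w) ?_ (by fun_prop)
      simpa using hφ
    obtain ⟨G, hG, hGe⟩ := hshift.exists_eq_sum_add_pow_mul (n + 1)
    have hcoef : ∀ i : ℕ, laurentCoeff g d (i - n) =
        iteratedDeriv i (fun w => φ (d + w)) 0 / (i.factorial : ℂ) := fun i => by
      have h1 : ((i : ℤ) - n - p).toNat = i := by omega
      simp only [laurentCoeff]
      rw [← hp, if_neg (by omega), h1, iteratedDeriv_comp_const_add]
      simp [hφdef, hF]
    have hc0 := hcoef n
    rw [sub_self] at hc0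
    have hψ : AnalyticAt ℂ (fun ζ => laurentCoeff g d 0 + (ζ - d) * G (ζ - d)) d := by
      have : AnalyticAt ℂ (fun ζ => G (ζ - d)) d :=
        AnalyticAt.fun_comp (g := G) (f := fun ζ => ζ - d) (by simpa using hG) (by fun_prop)
      exact analyticAt_const.add ((analyticAt_id.sub analyticAt_const).mul this)
    refine hψ.congr (Eventually.of_forall fun ζ => ?_)
    rcases eq_or_ne ζ d with rfl | hne
    · simp only
      rw [principalPart_self, hval]; simp
    · have hne' : ζ - d ≠ 0 := sub_ne_zero.2 hne
      have h1 : φ ζ = (ζ - d) ^ (-p) * g ζ :=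
        (hFm.eqOn_compl_singleton_toMeromorphicNFAt hne).symm
      have h2 := hGe (ζ - d)
      rw [add_sub_cancel, h1, Finset.sum_range_succ] at h2
      have h3 : g ζ = (ζ - d) ^ p * ((ζ - d) ^ (-p) * g ζ) := by
        rw [← mul_assoc, ← zpow_add₀ hne', add_neg_cancel, zpow_zero, one_mul]
      simp only
      rw [h3, h2, principalPart_eq_sum_range hpn, mul_add, mul_add, Finset.mul_sum]
      have h4 : ∀ i ∈ Finset.range n, (ζ - d) ^ p *
          (((ζ - d) ^ i / (i.factorial : ℂ)) • iteratedDeriv i (fun w => φ (d + w)) 0) =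
          laurentCoeff g d (i - n) * (ζ - d) ^ ((i : ℤ) - n) := fun i _ => by
        have e : (ζ - d) ^ ((i : ℤ) - n) = (ζ - d) ^ p * (ζ - d) ^ i := by
          rw [← zpow_natCast, ← zpow_add₀ hne']; congr 1; omega
        rw [hcoef, e, smul_eq_mul]; ring
      have h5 : (ζ - d) ^ p * (ζ - d) ^ n = 1 := by
        rw [hn, ← zpow_natCast, ← zpow_add₀ hne', neg_add_cancel, zpow_zero]
      rw [Finset.sum_congr rfl h4, hc0, pow_succ]
      simp only [smul_eq_mul]
      linear_combination (-(iteratedDeriv n (fun w => φ (d + w)) 0 / (n.factorial : ℂ))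
        - (ζ - d) * G (ζ - d)) * h5

lemma untop₀_nonneg_of_not_isPole {g : ℂ → ℂ} {d : ℂ} (h : ¬ IsPole g d) :
    0 ≤ (meromorphicOrderAt g d).untop₀ := by
  rw [IsPole, not_lt] at h
  cases ho : meromorphicOrderAt g d with
  | top => simp
  | coe m => rw [ho] at h; exact_mod_cast h

lemma analyticAt_of_not_isPole {g : ℂ → ℂ} {d : ℂ} (hg : MeromorphicAt g d)
    (hval : g d = laurentCoeff g d 0) (h : ¬ IsPole g d) : AnalyticAt ℂ g d := by
  have := analyticAt_sub_principalPart hg hval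
  simpa only [principalPart_eq_zero (untop₀_nonneg_of_not_isPole h), sub_zero] using this

lemma not_isPole_of_analyticAt {g : ℂ → ℂ} {d : ℂ} (h : AnalyticAt ℂ g d) : ¬ IsPole g d :=
  not_lt.2 h.meromorphicOrderAt_nonneg

/-- Infinitely many poles would accumulate in K, but a meromorphic function is analytic on a
punctured neighbourhood of each point. -/
lemma finite_setOf_isPole {g : ℂ → ℂ} (hg : ∀ ω, MeromorphicAt g ω) {K : Set ℂ}
    (hK : IsCompact K) : {d : ℂ | d ∈ K ∧ IsPole g d}.Finite := by
  by_contra hinf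
  obtain ⟨x, -, hx⟩ := Set.Infinite.exists_accPt_of_subset_isCompact hinf hK (fun d hd => hd.1)
  rw [accPt_iff_frequently_nhdsNE] at hx
  obtain ⟨y, hy, hy'⟩ := (hx.and_eventually (hg x).eventually_analyticAt).exists
  exact not_isPole_of_analyticAt hy' hy.2

/-! ### Parallelograms and their boundaries -/

/-- The image of `I × I` under `(s, t) ↦ c + s u + t v`. -/
def box (c u v : ℂ) (I : Set ℝ) : Set ℂ := {w | ∃ s ∈ I, ∃ t ∈ I, w = c + s * u + t * v}

/-- The boundary of the parallelogram with center `c` and half-sides `u`, `v`. -/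
def boxBdry (c u v : ℂ) : Set ℂ :=
  {w | ∃ s ∈ Set.Icc (-1 : ℝ) 1, ∃ t ∈ Set.Icc (-1 : ℝ) 1, (|s| = 1 ∨ |t| = 1) ∧
    w = c + s * u + t * v}

lemma convex_box (c u v : ℂ) {I : Set ℝ} (hI : Convex ℝ I) : Convex ℝ (box c u v I) := by
  rintro _ ⟨s, hs, t, ht, rfl⟩ _ ⟨s', hs', t', ht', rfl⟩ a b ha hb hab
  refine ⟨_, hI hs hs' ha hb hab, _, hI ht ht' ha hb hab, ?_⟩
  have : (a : ℂ) + b = 1 := by exact_mod_cast hab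
  simp only [Complex.real_smul, smul_eq_mul, Complex.ofReal_add, Complex.ofReal_mul]
  linear_combination c * this

lemma isCompact_box (c u v : ℂ) {I : Set ℝ} (hI : IsCompact I) : IsCompact (box c u v I) := by
  have : box c u v I = (fun p : ℝ × ℝ => c + p.1 * u + p.2 * v) '' (I ×ˢ I) := by
    ext w
    constructor
    · rintro ⟨s, hs, t, ht, rfl⟩; exact ⟨(s, t), ⟨hs, ht⟩, rfl⟩
    · rintro ⟨⟨s, t⟩, ⟨hs, ht⟩, rfl⟩; exact ⟨s, hs, t, ht, rfl⟩
  rw [this]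
  exact (hI.prod hI).image (by fun_prop)

lemma boxBdry_subset (c u v : ℂ) : boxBdry c u v ⊆ box c u v (Set.Icc (-1) 1) := by
  rintro _ ⟨s, hs, t, ht, -, rfl⟩; exact ⟨s, hs, t, ht, rfl⟩

lemma mapsTo_boxBdry_reflect (c u v : ℂ) :
    Set.MapsTo (fun ζ => 2 * c - ζ) (boxBdry c u v) (boxBdry c u v) := by
  rintro _ ⟨s, hs, t, ht, h1, rfl⟩
  refine ⟨-s, ?_, -t, ?_, by simpa using h1, by push_cast; ring⟩
  · constructor <;> linarith [hs.1, hs.2]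
  · constructor <;> linarith [ht.1, ht.2]

lemma center_mem_box (c u v : ℂ) : c ∈ box c u v (Set.Ioo (-1) 1) :=
  ⟨0, by norm_num, 0, by norm_num, by simp⟩

section Bdry

variable (c u v : ℂ) {t : ℝ} (ht : t ∈ Set.Icc (-1 : ℝ) 1)

include ht

lemma right_mem_boxBdry : c + u + t * v ∈ boxBdry c u v :=
  ⟨1, by norm_num, t, ht, by simp, by simp⟩

lemma left_mem_boxBdry : c - u + t * (-v) ∈ boxBdry c u v :=
  ⟨-1, by norm_num, -t, by constructor <;> linarith [ht.1, ht.2], by simp, by push_cast; ring⟩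

lemma top_mem_boxBdry : c + v + t * (-u) ∈ boxBdry c u v :=
  ⟨-t, by constructor <;> linarith [ht.1, ht.2], 1, by norm_num, by simp, by push_cast; ring⟩

lemma bottom_mem_boxBdry : c - v + t * u ∈ boxBdry c u v :=
  ⟨t, ht, -1, by norm_num, by simp, by push_cast; ring⟩

end Bdry

lemma eq_of_add_mul_eq {u v : ℂ} (h : LinearIndependent ℝ ![u, v]) {s t s' t' : ℝ}
    (e : (s : ℂ) * u + t * v = s' * u + t' * v) : s = s' ∧ t = t' := by
  have := (LinearIndependent.pair_iff.1 h) (s - s') (t - t') (by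
    simp only [Complex.real_smul, Complex.ofReal_sub]
    linear_combination e)
  exact ⟨sub_eq_zero.1 this.1, sub_eq_zero.1 this.2⟩

lemma ne_of_mem_of_mem_bdry {c u v : ℂ} (h : LinearIndependent ℝ ![u, v]) {ζ d : ℂ}
    (hζ : ζ ∈ boxBdry c u v) (hd : d ∈ box c u v (Set.Ioo (-1) 1)) : ζ ≠ d := by
  rintro rfl
  obtain ⟨s, -, t, -, h1, rfl⟩ := hζ
  obtain ⟨s', hs', t', ht', e⟩ := hd
  obtain ⟨rfl, rfl⟩ := eq_of_add_mul_eq h (s := s) (t := t) (s' := s') (t' := t')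
    (by linear_combination e)
  rcases h1 with h1 | h1
  · exact (abs_lt.2 ⟨hs'.1, hs'.2⟩).ne h1
  · exact (abs_lt.2 ⟨ht'.1, ht'.2⟩).ne h1

lemma mem_bdry_or_mem_box {c u v w : ℂ} (hw : w ∈ box c u v (Set.Icc (-1) 1)) :
    w ∈ boxBdry c u v ∨ w ∈ box c u v (Set.Ioo (-1) 1) := by
  obtain ⟨s, hs, t, ht, rfl⟩ := hw
  by_cases h : |s| = 1 ∨ |t| = 1
  · exact .inl ⟨s, hs, t, ht, h, rfl⟩
  · push Not at h
    refine .inr ⟨s, ?_, t, ?_, rfl⟩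
    · exact abs_lt.1 (lt_of_le_of_ne (abs_le.2 hs) h.1)
    · exact abs_lt.1 (lt_of_le_of_ne (abs_le.2 ht) h.2)

/-- Dilating by 1 + ε from the centre pushes an edge point out of the parallelogram. This inclusion
transfers the bounds assumed on the topological boundary to the edges. -/
lemma boxBdry_subset_frontier {c u v : ℂ} (h : LinearIndependent ℝ ![u, v]) :
    boxBdry c u v ⊆ frontier (box c u v (Set.Icc (-1) 1)) := by
  intro w hw
  have hcl := (isCompact_box c u v (isCompact_Icc (a := (-1 : ℝ)) (b := 1))).isClosed
  rw [hcl.frontier_eq]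
  refine ⟨boxBdry_subset c u v hw, fun hint => ?_⟩
  have hcont : ContinuousAt (fun ε : ℝ => c + (1 + (ε : ℂ)) * (w - c)) 0 := by fun_prop
  have hev : ∀ᶠ ε : ℝ in 𝓝[>] 0, c + (1 + (ε : ℂ)) * (w - c) ∈ box c u v (Set.Icc (-1) 1) := by
    refine nhdsWithin_le_nhds ((hcont.eventually_mem ?_))
    have : c + (1 + ((0 : ℝ) : ℂ)) * (w - c) = w := by simp
    rw [this]
    exact mem_interior_iff_mem_nhds.1 hint
  obtain ⟨ε, hε, hε0⟩ := (hev.and self_mem_nhdsWithin).exists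
  have hε0 : 0 < ε := hε0
  obtain ⟨s, -, t, -, h1, rfl⟩ := hw
  obtain ⟨s', hs', t', ht', e⟩ := hε
  obtain ⟨e1, e2⟩ := eq_of_add_mul_eq h (s := (1 + ε) * s) (t := (1 + ε) * t) (s' := s') (t' := t')
    (by push_cast; linear_combination e)
  have aux : ∀ a b : ℝ, (1 + ε) * a = b → b ∈ Set.Icc (-1 : ℝ) 1 → |a| ≠ 1 := fun a b hab hb ha => by
    have := abs_le.2 hb
    rw [← hab, abs_mul, ha, abs_of_pos (by linarith)] at this
    linarith
  rcases h1 with h1 | h1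
  · exact aux _ _ e1 hs' h1
  · exact aux _ _ e2 ht' h1

/-! ### Integration along the boundary of a parallelogram -/

/-- The integral of `f` along the segment from `a - b` to `a + b`. -/
def edgeIntegral (f : ℂ → ℂ) (a b : ℂ) : ℂ := ∫ t in (-1 : ℝ)..1, b * f (a + t * b)

/-- The integral of `f` along the boundary of the parallelogram with center `c` and half-sides
`u`, `v`. -/
def boxIntegral (f : ℂ → ℂ) (c u v : ℂ) : ℂ :=
  edgeIntegral f (c + u) v + edgeIntegral f (c + v) (-u) + edgeIntegral f (c - u) (-v) +
    edgeIntegral f (c - v) u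

lemma mem_Icc_of_mem_uIcc {t : ℝ} (ht : t ∈ Set.uIcc (-1 : ℝ) 1) : t ∈ Set.Icc (-1 : ℝ) 1 := by
  rwa [Set.uIcc_of_le (by norm_num)] at ht

lemma edgeIntegral_congr {f g : ℂ → ℂ} {a b : ℂ}
    (h : ∀ t ∈ Set.Icc (-1 : ℝ) 1, f (a + t * b) = g (a + t * b)) :
    edgeIntegral f a b = edgeIntegral g a b :=
  intervalIntegral.integral_congr fun t ht => by
    rw [h t (mem_Icc_of_mem_uIcc ht)]

lemma intervalIntegrable_edge {f : ℂ → ℂ} {a b : ℂ} {B : Set ℂ} (hf : ContinuousOn f B)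
    (h : ∀ t ∈ Set.Icc (-1 : ℝ) 1, a + t * b ∈ B) :
    IntervalIntegrable (fun t : ℝ => b * f (a + t * b)) MeasureTheory.volume (-1) 1 := by
  apply ContinuousOn.intervalIntegrable
  refine continuousOn_const.mul (hf.comp (by fun_prop) fun t ht => h t (mem_Icc_of_mem_uIcc ht))

lemma edgeIntegral_add {f g : ℂ → ℂ} {a b : ℂ} {B : Set ℂ} (hf : ContinuousOn f B)
    (hg : ContinuousOn g B) (h : ∀ t ∈ Set.Icc (-1 : ℝ) 1, a + t * b ∈ B) :
    edgeIntegral (fun ζ => f ζ + g ζ) a b = edgeIntegral f a b + edgeIntegral g a b := by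
  unfold edgeIntegral
  rw [← intervalIntegral.integral_add (intervalIntegrable_edge hf h) (intervalIntegrable_edge hg h)]
  simp only [mul_add]

lemma edgeIntegral_const_mul (k : ℂ) (f : ℂ → ℂ) (a b : ℂ) :
    edgeIntegral (fun ζ => k * f ζ) a b = k * edgeIntegral f a b := by
  unfold edgeIntegral
  rw [← intervalIntegral.integral_const_mul]
  congr 1
  ext t
  ring

lemma edgeIntegral_eq_sub {f F : ℂ → ℂ} {a b : ℂ} {B : Set ℂ} (hf : ContinuousOn f B)
    (h : ∀ t ∈ Set.Icc (-1 : ℝ) 1, a + t * b ∈ B) (hF : ∀ ζ ∈ B, HasDerivAt F (f ζ) ζ) :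
    edgeIntegral f a b = F (a + b) - F (a - b) := by
  unfold edgeIntegral
  rw [intervalIntegral.integral_eq_sub_of_hasDerivAt (f := fun t : ℝ => F (a + t * b)) ?_
    (intervalIntegrable_edge hf h)]
  · simp [sub_eq_add_neg]
  · intro t ht
    have h1 : HasDerivAt (fun t : ℝ => a + (t : ℂ) * b) b t := by
      simpa using ((Complex.ofRealCLM.hasDerivAt (x := t)).mul_const b).const_add a
    have h2 := (hF _ (h t (mem_Icc_of_mem_uIcc ht))).comp t h1
    rwa [mul_comm] at h2

lemma boxIntegral_congr {f g : ℂ → ℂ} {c u v : ℂ} (h : ∀ ζ ∈ boxBdry c u v, f ζ = g ζ) :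
    boxIntegral f c u v = boxIntegral g c u v := by
  unfold boxIntegral
  rw [edgeIntegral_congr fun t ht => h _ (right_mem_boxBdry c u v ht),
    edgeIntegral_congr fun t ht => h _ (left_mem_boxBdry c u v ht),
    edgeIntegral_congr fun t ht => h _ (top_mem_boxBdry c u v ht),
    edgeIntegral_congr fun t ht => h _ (bottom_mem_boxBdry c u v ht)]

lemma boxIntegral_add {f g : ℂ → ℂ} {c u v : ℂ} (hf : ContinuousOn f (boxBdry c u v))
    (hg : ContinuousOn g (boxBdry c u v)) :
    boxIntegral (fun ζ => f ζ + g ζ) c u v = boxIntegral f c u v + boxIntegral g c u v := by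
  unfold boxIntegral
  rw [edgeIntegral_add hf hg fun t ht => right_mem_boxBdry c u v ht,
    edgeIntegral_add hf hg fun t ht => left_mem_boxBdry c u v ht,
    edgeIntegral_add hf hg fun t ht => top_mem_boxBdry c u v ht,
    edgeIntegral_add hf hg fun t ht => bottom_mem_boxBdry c u v ht]
  ring

lemma boxIntegral_const_mul (k : ℂ) (f : ℂ → ℂ) (c u v : ℂ) :
    boxIntegral (fun ζ => k * f ζ) c u v = k * boxIntegral f c u v := by
  unfold boxIntegral
  simp only [edgeIntegral_const_mul]
  ring

lemma boxIntegral_sub {f g : ℂ → ℂ} {c u v : ℂ} (hf : ContinuousOn f (boxBdry c u v))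
    (hg : ContinuousOn g (boxBdry c u v)) :
    boxIntegral (fun ζ => f ζ - g ζ) c u v = boxIntegral f c u v - boxIntegral g c u v := by
  have := boxIntegral_add (g := fun ζ => (-1) * g ζ) hf (continuousOn_const.mul hg)
  rw [boxIntegral_const_mul] at this
  rw [sub_eq_add_neg, ← neg_one_mul, ← this]
  congr 1
  ext ζ
  ring

lemma boxIntegral_sum {ι : Type*} (s : Finset ι) {f : ι → ℂ → ℂ} {c u v : ℂ}
    (hf : ∀ i ∈ s, ContinuousOn (f i) (boxBdry c u v)) :
    boxIntegral (fun ζ => ∑ i ∈ s, f i ζ) c u v = ∑ i ∈ s, boxIntegral (f i) c u v := by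
  classical
  induction s using Finset.induction_on with
  | empty => simp [boxIntegral, edgeIntegral]
  | insert i s hi ih =>
    simp only [Finset.sum_insert hi]
    rw [boxIntegral_add (hf i (Finset.mem_insert_self i s))
      (continuousOn_finsetSum _ fun j hj => hf j (Finset.mem_insert_of_mem hj)),
      ih fun j hj => hf j (Finset.mem_insert_of_mem hj)]

/-- The values of the primitive at the four vertices cancel. -/
lemma boxIntegral_eq_zero_of_hasDerivAt {f F : ℂ → ℂ} {c u v : ℂ}
    (hf : ContinuousOn f (boxBdry c u v)) (hF : ∀ ζ ∈ boxBdry c u v, HasDerivAt F (f ζ) ζ) :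
    boxIntegral f c u v = 0 := by
  unfold boxIntegral
  rw [edgeIntegral_eq_sub hf (fun t ht => right_mem_boxBdry c u v ht) hF,
    edgeIntegral_eq_sub hf (fun t ht => left_mem_boxBdry c u v ht) hF,
    edgeIntegral_eq_sub hf (fun t ht => top_mem_boxBdry c u v ht) hF,
    edgeIntegral_eq_sub hf (fun t ht => bottom_mem_boxBdry c u v ht) hF]
  rw [show c + v - -u = c + u + v by ring, show c - u - -v = c + v + -u by ring,
    show c - v - u = c - u + -v by ring, show c - v + u = c + u - v by ring]
  ring

/-- Cauchy's theorem for a parallelogram. -/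
lemma boxIntegral_eq_zero_of_differentiableOn {f : ℂ → ℂ} {c u v : ℂ} {U : Set ℂ} (hU : IsOpen U)
    (hsub : box c u v (Set.Icc (-1) 1) ⊆ U) (hf : DifferentiableOn ℂ f U) :
    boxIntegral f c u v = 0 := by
  -- A thickening of a convex set is convex, and a holomorphic function on a convex open set has a
  -- primitive.
  obtain ⟨δ, hδ, hδU⟩ := (isCompact_box c u v
    (isCompact_Icc (a := (-1 : ℝ)) (b := 1))).exists_thickening_subset_open hU hsub
  set T := Metric.thickening δ (box c u v (Set.Icc (-1) 1))
  have hT : Convex ℝ T := (convex_box c u v (convex_Icc (-1) 1)).thickening δ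
  obtain ⟨F, hF⟩ := hT.exists_forall_hasDerivWithinAt (hf.mono hδU)
  have hBT : boxBdry c u v ⊆ T :=
    (boxBdry_subset c u v).trans (Metric.self_subset_thickening hδ _)
  refine boxIntegral_eq_zero_of_hasDerivAt (hf.continuousOn.mono (hBT.trans hδU))
    (F := F) fun ζ hζ => (hF ζ (hBT hζ)).hasDerivAt (Metric.isOpen_thickening.mem_nhds (hBT hζ))

/-- Divided by its starting value a − b, ζ − c stays in the slit plane along the edge, so the
principal logarithm is a primitive there. -/
lemma edgeIntegral_inv_sub_center {a b : ℂ} (hab : LinearIndependent ℝ ![a, b]) (c : ℂ) :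
    edgeIntegral (fun ζ => (ζ - c)⁻¹) (c + a) b = Complex.log ((a + b) / (a - b)) := by
  have hne : ∀ s t : ℝ, s ≠ 0 → (s : ℂ) * a + t * b ≠ 0 := fun s t hs e => hs
    (eq_of_add_mul_eq hab (s := s) (t := t) (s' := 0) (t' := 0) (by simpa using e)).1
  have h0 : a - b ≠ 0 := by simpa [sub_eq_add_neg] using hne 1 (-1) one_ne_zero
  let B : Set ℂ := {ζ | (ζ - c) / (a - b) ∈ Complex.slitPlane}
  have hBne : ∀ ζ ∈ B, ζ - c ≠ 0 := fun ζ hζ e => by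
    have := Complex.slitPlane_ne_zero hζ
    simp [e] at this
  rw [edgeIntegral_eq_sub (f := fun ζ => (ζ - c)⁻¹) (B := B)
    (F := fun ζ => Complex.log ((ζ - c) / (a - b)))
    ((continuousOn_id.sub continuousOn_const).inv₀ hBne) ?_ ?_]
  · rw [show c + a + b - c = a + b by ring, show c + a - b - c = a - b by ring, div_self h0,
      Complex.log_one, sub_zero]
  · intro t _
    simp only [B, Set.mem_ofPred_eq]
    rw [Complex.mem_slitPlane_iff_not_le_zero]
    intro hle
    rw [Complex.le_def] at hle
    obtain ⟨hre, him⟩ := hle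
    set q := (c + a + t * b - c) / (a - b) with hq
    have hqr : q = ((q.re : ℝ) : ℂ) := Complex.ext rfl (by simpa using him)
    have hre' : q.re ≤ 0 := hre
    have e : c + a + t * b - c = q.re * (a - b) := by
      rw [← hqr, hq, div_mul_cancel₀ _ h0]
    -- A quotient q ≤ 0 would give a relation between a and b with coefficient 1 − q > 0 on a.
    refine hne (1 - q.re) (t + q.re) (by linarith) ?_
    push_cast
    linear_combination e
  · intro ζ hζ
    have hd1 : HasDerivAt (fun ζ : ℂ => (ζ - c) / (a - b)) (1 / (a - b)) ζ :=
      ((hasDerivAt_id ζ).sub_const c).div_const _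
    have hd2 := hd1.clog hζ
    convert hd2 using 1
    have := hBne ζ hζ
    field_simp

section Interior

variable {c u v : ℂ} (h : LinearIndependent ℝ ![u, v])

include h

lemma continuousOn_inv_sub {d : ℂ} (hd : d ∈ box c u v (Set.Ioo (-1) 1)) :
    ContinuousOn (fun ζ => (ζ - d)⁻¹) (boxBdry c u v) :=
  (continuousOn_id.sub continuousOn_const).inv₀ fun _ hζ =>
    sub_ne_zero.2 (ne_of_mem_of_mem_bdry h hζ hd)

/-- The function log((ζ − ω)/(ζ − d)) is a primitive of the difference. A quotient in (−∞, 0] would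
put ζ on the segment from ω to d, which lies in the interior by convexity. -/
lemma boxIntegral_inv_sub_eq {ω d : ℂ} (hω : ω ∈ box c u v (Set.Ioo (-1) 1))
    (hd : d ∈ box c u v (Set.Ioo (-1) 1)) :
    boxIntegral (fun ζ => (ζ - ω)⁻¹) c u v = boxIntegral (fun ζ => (ζ - d)⁻¹) c u v := by
  rw [← sub_eq_zero, ← boxIntegral_sub (continuousOn_inv_sub h hω) (continuousOn_inv_sub h hd)]
  refine boxIntegral_eq_zero_of_hasDerivAt
    ((continuousOn_inv_sub h hω).sub (continuousOn_inv_sub h hd))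
    (F := fun ζ => Complex.log ((ζ - ω) / (ζ - d))) fun ζ hζ => ?_
  have h1 : ζ - ω ≠ 0 := sub_ne_zero.2 (ne_of_mem_of_mem_bdry h hζ hω)
  have h2 : ζ - d ≠ 0 := sub_ne_zero.2 (ne_of_mem_of_mem_bdry h hζ hd)
  have hslit : (ζ - ω) / (ζ - d) ∈ Complex.slitPlane := by
    rw [Complex.mem_slitPlane_iff_not_le_zero]
    intro hle
    rw [Complex.le_def] at hle
    obtain ⟨hre, him⟩ := hle
    set q := (ζ - ω) / (ζ - d) with hq
    have hqr : q = ((q.re : ℝ) : ℂ) := Complex.ext rfl (by simpa using him)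
    have hre' : q.re ≤ 0 := hre
    have e : ζ - ω = q.re * (ζ - d) := by
      rw [← hqr, hq, div_mul_cancel₀ _ h2]
    have hk : (1 : ℝ) - q.re ≠ 0 := by linarith
    have hkc : (1 : ℂ) - q.re ≠ 0 := by exact_mod_cast hk
    have hmem := convex_box c u v (convex_Ioo (-1) 1) hω hd
      (a := 1 / (1 - q.re)) (b := -q.re / (1 - q.re))
      (div_nonneg zero_le_one (by linarith)) (div_nonneg (by linarith) (by linarith))
      (by field_simp; ring)
    refine ne_of_mem_of_mem_bdry h hζ hmem ?_
    simp only [Complex.real_smul]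
    push_cast
    field_simp
    linear_combination e
  have hd1 : HasDerivAt (fun ζ : ℂ => (ζ - ω) / (ζ - d))
      ((1 * (ζ - d) - (ζ - ω) * 1) / (ζ - d) ^ 2) ζ :=
    ((hasDerivAt_id ζ).sub_const ω).div ((hasDerivAt_id ζ).sub_const d) h2
  have hd2 := hd1.clog hslit
  convert hd2 using 1
  field_simp

/-- The integral `∮ dζ / (ζ - c)` is `2 π i` up to an odd integer factor; all we need of it is a
lower bound. -/
lemma one_le_norm_boxIntegral_inv_sub_center :
    1 ≤ ‖boxIntegral (fun ζ => (ζ - c)⁻¹) c u v‖ := by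
  have hne : ∀ s t : ℝ, s ≠ 0 → (s : ℂ) * u + t * v ≠ 0 := fun s t hs e => hs
    (eq_of_add_mul_eq h (s := s) (t := t) (s' := 0) (t' := 0) (by simpa using e)).1
  have h1 : u + v ≠ 0 := by simpa using hne 1 1 one_ne_zero
  have h2 : u - v ≠ 0 := by simpa [sub_eq_add_neg] using hne 1 (-1) one_ne_zero
  have h3 : v - u ≠ 0 := by rw [← neg_sub]; exact neg_ne_zero.2 h2
  have i1 : LinearIndependent ℝ ![v, -u] := by
    rw [LinearIndependent.pair_iff] at h ⊢
    intro s t e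
    have := h (-t) s (by rw [← e]; simp; ring)
    exact ⟨this.2, by simpa using this.1⟩
  have i2 : LinearIndependent ℝ ![-u, -v] := by
    rw [LinearIndependent.pair_iff] at h ⊢
    intro s t e
    have := h (-s) (-t) (by rw [← e]; simp)
    simpa using this
  have i3 : LinearIndependent ℝ ![-v, u] := by
    rw [LinearIndependent.pair_iff] at h ⊢
    intro s t e
    have := h t (-s) (by rw [← e]; simp; ring)
    exact ⟨by simpa using this.2, this.1⟩
  set x := Complex.log ((u + v) / (u - v)) + Complex.log ((v - u) / (v + u)) with hx
  have hN : boxIntegral (fun ζ => (ζ - c)⁻¹) c u v = 2 * x := by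
    unfold boxIntegral
    rw [edgeIntegral_inv_sub_center h, edgeIntegral_inv_sub_center i1, sub_eq_add_neg c u,
      sub_eq_add_neg c v, edgeIntegral_inv_sub_center i2, edgeIntegral_inv_sub_center i3, hx,
      show (-u + -v) / (-u - -v) = (u + v) / (u - v) by
        rw [← neg_div_neg_eq]; congr 1 <;> ring,
      show (-v + u) / (-v - u) = (v - u) / (v + u) by
        rw [← neg_div_neg_eq]; congr 1 <;> ring,
      ← sub_eq_add_neg, sub_neg_eq_add]
    ring
  have hexp : Complex.exp x = -1 := by
    rw [hx, Complex.exp_add, Complex.exp_log (div_ne_zero h1 h2),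
      Complex.exp_log (div_ne_zero h3 (by rwa [add_comm])), div_mul_div_comm,
      div_eq_iff (mul_ne_zero h2 (by rwa [add_comm]))]
    ring
  rw [hN]
  -- If ‖x‖ < 1/2 then ‖exp x − 1‖ ≤ 2‖x‖ < 1, whereas exp x − 1 = −2.
  by_contra! hlt
  rw [norm_mul, Complex.norm_ofNat] at hlt
  have := Complex.norm_exp_sub_one_le (x := x) (by linarith)
  rw [hexp] at this
  norm_num at this
  linarith

lemma boxIntegral_inv_sub_pow {d : ℂ} (hd : d ∈ box c u v (Set.Ioo (-1) 1)) (j : ℕ) :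
    boxIntegral (fun ζ => (ζ - d)⁻¹ ^ (j + 2)) c u v = 0 := by
  refine boxIntegral_eq_zero_of_hasDerivAt ((continuousOn_inv_sub h hd).fun_pow _)
    (F := fun ζ => -(1 / (j + 1 : ℂ)) * (ζ - d)⁻¹ ^ (j + 1)) fun ζ hζ => ?_
  have h1 : ζ - d ≠ 0 := sub_ne_zero.2 (ne_of_mem_of_mem_bdry h hζ hd)
  have h2 : HasDerivAt (fun ζ => (ζ - d)⁻¹) (-1 / (ζ - d) ^ 2) ζ :=
    ((hasDerivAt_id ζ).sub_const d).inv h1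
  have h3 := (h2.pow (j + 1)).const_mul (-(1 / (j + 1 : ℂ)))
  have h4 : (j + 1 : ℂ) ≠ 0 := by exact_mod_cast j.succ_ne_zero
  refine h3.congr_deriv ?_
  rw [add_tsub_cancel_right, Nat.cast_add, Nat.cast_one, div_eq_mul_inv (-1) ((ζ - d) ^ 2),
    ← inv_pow, pow_add]
  field_simp

/-- Partial fractions reduce to pure powers, which have primitives, and to the equality of the
integrals of 1/(ζ − ω) and 1/(ζ − d). For ω = d only a pure power is left. -/
lemma boxIntegral_inv_sub_pow_mul_inv_sub {d ω : ℂ} (hd : d ∈ box c u v (Set.Ioo (-1) 1))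
    (hω : ω ∈ box c u v (Set.Ioo (-1) 1)) (j : ℕ) :
    boxIntegral (fun ζ => (ζ - d)⁻¹ ^ (j + 1) * (ζ - ω)⁻¹) c u v = 0 := by
  rcases eq_or_ne ω d with rfl | hne
  · simpa only [← pow_succ] using boxIntegral_inv_sub_pow h hd j
  have hcd := continuousOn_inv_sub h hd
  have hcω := continuousOn_inv_sub h hω
  have hne' : ω - d ≠ 0 := sub_ne_zero.2 hne
  have key : ∀ ζ ∈ boxBdry c u v,
      (ζ - d)⁻¹ * (ζ - ω)⁻¹ = (ω - d)⁻¹ * ((ζ - ω)⁻¹ - (ζ - d)⁻¹) := fun ζ hζ => by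
    have h1 : ζ - d ≠ 0 := sub_ne_zero.2 (ne_of_mem_of_mem_bdry h hζ hd)
    have h2 : ζ - ω ≠ 0 := sub_ne_zero.2 (ne_of_mem_of_mem_bdry h hζ hω)
    rw [inv_sub_inv h2 h1]
    field_simp
    ring
  induction j with
  | zero =>
    have e : boxIntegral (fun ζ => (ζ - d)⁻¹ ^ (0 + 1) * (ζ - ω)⁻¹) c u v =
        boxIntegral (fun ζ => (ω - d)⁻¹ * ((ζ - ω)⁻¹ - (ζ - d)⁻¹)) c u v :=
      boxIntegral_congr fun ζ hζ => by
        rw [zero_add, pow_one, key ζ hζ]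
    rw [e, boxIntegral_const_mul, boxIntegral_sub hcω hcd, boxIntegral_inv_sub_eq h hω hd,
      sub_self, mul_zero]
  | succ j ih =>
    have e : boxIntegral (fun ζ => (ζ - d)⁻¹ ^ (j + 1 + 1) * (ζ - ω)⁻¹) c u v =
        boxIntegral (fun ζ => (ω - d)⁻¹ *
          ((ζ - d)⁻¹ ^ (j + 1) * (ζ - ω)⁻¹ - (ζ - d)⁻¹ ^ (j + 2))) c u v :=
      boxIntegral_congr fun ζ hζ => by
        rw [pow_succ, mul_assoc, key ζ hζ]
        ring
    rw [e, boxIntegral_const_mul, boxIntegral_sub ((hcd.fun_pow _).fun_mul hcω) (hcd.fun_pow _), ih,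
      boxIntegral_inv_sub_pow h hd, sub_self, mul_zero]

lemma continuousOn_principalPart {g : ℂ → ℂ} {d : ℂ} (hd : d ∈ box c u v (Set.Ioo (-1) 1)) :
    ContinuousOn (principalPart g d) (boxBdry c u v) := fun _ hζ =>
  (analyticAt_principalPart (ne_of_mem_of_mem_bdry h hζ hd)).continuousAt.continuousWithinAt

/-- Subtracting principal parts therefore does not change the Cauchy integral of a function. -/
lemma boxIntegral_principalPart_mul_inv_sub {g : ℂ → ℂ} {d ω : ℂ}
    (hd : d ∈ box c u v (Set.Ioo (-1) 1)) (hω : ω ∈ box c u v (Set.Ioo (-1) 1)) :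
    boxIntegral (fun ζ => principalPart g d ζ * (ζ - ω)⁻¹) c u v = 0 := by
  have e : ∀ ζ, principalPart g d ζ * (ζ - ω)⁻¹ =
      ∑ k ∈ Finset.Ico ((meromorphicOrderAt g d).untop₀) 0,
        laurentCoeff g d k * ((ζ - d)⁻¹ ^ ((-k - 1).toNat + 1) * (ζ - ω)⁻¹) := fun ζ => by
    rw [principalPart, Finset.sum_mul]
    refine Finset.sum_congr rfl fun k hk => ?_
    have hk' := (Finset.mem_Ico.1 hk).2
    have : (ζ - d) ^ k = (ζ - d)⁻¹ ^ ((-k - 1).toNat + 1) := by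
      rw [← zpow_natCast, inv_zpow', show (-(((-k - 1).toNat + 1 : ℕ) : ℤ)) = k by omega]
    rw [this, mul_assoc]
  simp only [e]
  rw [boxIntegral_sum]
  · refine Finset.sum_eq_zero fun k _ => ?_
    rw [boxIntegral_const_mul, boxIntegral_inv_sub_pow_mul_inv_sub h hd hω, mul_zero]
  · intro k _
    exact continuousOn_const.fun_mul
      (((continuousOn_inv_sub h hd).fun_pow _).fun_mul (continuousOn_inv_sub h hω))

/-- Cauchy's formula for a parallelogram. -/
lemma boxIntegral_mul_inv_sub {f : ℂ → ℂ}
    (hf : ∀ ζ ∈ box c u v (Set.Icc (-1) 1), AnalyticAt ℂ f ζ) {ω : ℂ}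
    (hω : ω ∈ box c u v (Set.Ioo (-1) 1)) :
    boxIntegral (fun ζ => f ζ * (ζ - ω)⁻¹) c u v =
      f ω * boxIntegral (fun ζ => (ζ - c)⁻¹) c u v := by
  have hU : IsOpen {ζ | AnalyticAt ℂ f ζ} := isOpen_analyticAt ℂ f
  have hωP : ω ∈ box c u v (Set.Icc (-1) 1) := by
    obtain ⟨s, hs, t, ht, rfl⟩ := hω
    exact ⟨s, Set.Ioo_subset_Icc_self hs, t, Set.Ioo_subset_Icc_self ht, rfl⟩
  have hdf : DifferentiableOn ℂ f {ζ | AnalyticAt ℂ f ζ} := fun ζ hζ =>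
    (show AnalyticAt ℂ f ζ from hζ).differentiableAt.differentiableWithinAt
  -- The divided difference (f(ζ) − f(ω))/(ζ − ω) has a removable singularity at ω, so Cauchy's
  -- theorem applies to it.
  have hds := (Complex.differentiableOn_dslope (hU.mem_nhds (hf ω hωP))).2 hdf
  have h0 := boxIntegral_eq_zero_of_differentiableOn hU (fun ζ hζ => hf ζ hζ) hds
  have hcω := continuousOn_inv_sub h hω
  have hcf : ContinuousOn f (boxBdry c u v) := fun ζ hζ =>
    (hf ζ (boxBdry_subset c u v hζ)).continuousAt.continuousWithinAt
  have e : boxIntegral (dslope f ω) c u v =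
      boxIntegral (fun ζ => f ζ * (ζ - ω)⁻¹ - f ω * (ζ - ω)⁻¹) c u v :=
    boxIntegral_congr fun ζ hζ => by
      rw [dslope_of_ne _ (ne_of_mem_of_mem_bdry h hζ hω), slope_def_field]
      ring
  rw [e, boxIntegral_sub (hcf.fun_mul hcω) (continuousOn_const.fun_mul hcω), boxIntegral_const_mul,
    boxIntegral_inv_sub_eq h hω (center_mem_box c u v), sub_eq_zero] at h0
  exact h0

/-- The residue theorem for `g(ζ) / (ζ - ω)` on a parallelogram. -/
lemma boxIntegral_meromorphic_mul_inv_sub {g : ℂ → ℂ} (hg : ∀ ζ, MeromorphicAt g ζ)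
    (hval : ∀ ζ, g ζ = laurentCoeff g ζ 0) (hbd : ∀ ζ ∈ boxBdry c u v, ¬ IsPole g ζ)
    {Z : Finset ℂ} (hZ : ∀ d, d ∈ Z ↔ d ∈ box c u v (Set.Icc (-1) 1) ∧ IsPole g d) {ω : ℂ}
    (hω : ω ∈ box c u v (Set.Ioo (-1) 1)) :
    boxIntegral (fun ζ => g ζ * (ζ - ω)⁻¹) c u v =
      (g ω - ∑ d ∈ Z, principalPart g d ω) * boxIntegral (fun ζ => (ζ - c)⁻¹) c u v := by
  have hZint : ∀ d ∈ Z, d ∈ box c u v (Set.Ioo (-1) 1) := fun d hd => by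
    obtain ⟨h1, h2⟩ := (hZ d).1 hd
    exact (mem_bdry_or_mem_box h1).resolve_left fun h3 => hbd d h3 h2
  have han : ∀ ζ ∈ box c u v (Set.Icc (-1) 1),
      AnalyticAt ℂ (fun ζ => g ζ - ∑ d ∈ Z, principalPart g d ζ) ζ := fun ζ hζ => by
    -- At a pole only its own principal part is singular, and it is grouped with g. The point ω may
    -- itself be a pole: `hval` fixes g there, and its own principal part contributes 0.
    by_cases hp : IsPole g ζ
    · have hmem := (hZ ζ).2 ⟨hζ, hp⟩
      have e : (fun ζ' => g ζ' - ∑ d ∈ Z, principalPart g d ζ') = fun ζ' =>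
          (g ζ' - principalPart g ζ ζ') - ∑ d ∈ Z.erase ζ, principalPart g d ζ' := by
        ext ζ'
        rw [← Finset.add_sum_erase Z _ hmem]
        ring
      rw [e]
      exact (analyticAt_sub_principalPart (hg ζ) (hval ζ)).sub
        (Finset.analyticAt_fun_sum _ fun d hd =>
          analyticAt_principalPart (Finset.ne_of_mem_erase hd).symm)
    · refine (analyticAt_of_not_isPole (hg ζ) (hval ζ) hp).sub
        (Finset.analyticAt_fun_sum _ fun d hd => analyticAt_principalPart ?_)
      rintro rfl
      exact hp ((hZ ζ).1 hd).2
  have hcω := continuousOn_inv_sub h hω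
  have hcg : ContinuousOn g (boxBdry c u v) := fun ζ hζ =>
    (analyticAt_of_not_isPole (hg ζ) (hval ζ) (hbd ζ hζ)).continuousAt.continuousWithinAt
  rw [← boxIntegral_mul_inv_sub h han hω]
  simp only [sub_mul, Finset.sum_mul]
  rw [boxIntegral_sub (hcg.fun_mul hcω) (continuousOn_finsetSum _ fun d hd =>
      (continuousOn_principalPart h (hZint d hd)).fun_mul hcω), boxIntegral_sum _ fun d hd =>
      (continuousOn_principalPart h (hZint d hd)).fun_mul hcω, Finset.sum_eq_zero fun d hd =>
      boxIntegral_principalPart_mul_inv_sub h (hZint d hd) hω, sub_zero]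

end Interior

/-! ### Estimates -/

lemma edgeIntegral_reflect (f : ℂ → ℂ) (c a b : ℂ) :
    edgeIntegral f (c - a) (-b) = -edgeIntegral (fun ζ => f (2 * c - ζ)) (c + a) b := by
  unfold edgeIntegral
  rw [← intervalIntegral.integral_neg]
  congr 1
  ext t
  rw [show c - a + (t : ℂ) * -b = 2 * c - (c + a + t * b) by ring]
  ring

/-- The primitive is an arctangent, of total variation at most π. The bound does not involve β,
which measures the length of the segment. -/
lemma integral_one_div_add_sq_le {h β t₀ : ℝ} (hh : 0 < h) (hβ : 0 < β) :
    ∫ t in (-1 : ℝ)..1, β / (h ^ 2 + (β * (t - t₀)) ^ 2) ≤ Real.pi / h := by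
  have hd : ∀ t : ℝ, HasDerivAt (fun t => 1 / h * Real.arctan (β / h * (t - t₀)))
      (β / (h ^ 2 + (β * (t - t₀)) ^ 2)) t := fun t => by
    have h1 : HasDerivAt (fun t => β / h * (t - t₀)) (β / h) t := by
      simpa using ((hasDerivAt_id t).sub_const t₀).const_mul (β / h)
    have h2 := h1.arctan.const_mul (1 / h)
    refine h2.congr_deriv ?_
    field_simp
  rw [intervalIntegral.integral_eq_sub_of_hasDerivAt (fun t _ => hd t)]
  · rw [← mul_sub, one_div, div_eq_inv_mul Real.pi]
    have h1 := (Real.arctan_lt_pi_div_two (β / h * (1 - t₀))).le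
    have h2 := (Real.neg_pi_div_two_lt_arctan (β / h * (-1 - t₀))).le
    exact mul_le_mul_of_nonneg_left (by linarith) (inv_nonneg.2 hh.le)
  · apply Continuous.intervalIntegrable
    have : ∀ t : ℝ, h ^ 2 + (β * (t - t₀)) ^ 2 ≠ 0 := fun t => by positivity
    fun_prop (disch := exact this _)

/-- If a segment stays at distance at least `h` from `0`, the integral along it of a function
bounded by `M / |x| ^ 3` is at most a constant multiple of `M / h ^ 2`, whatever its length. -/
lemma norm_edgeIntegral_le {f : ℂ → ℂ} {c a b : ℂ} {h M : ℝ} (hh : 0 < h) (hM : 0 ≤ M)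
    (hb : b ≠ 0) (hdist : ∀ t ∈ Set.Icc (-1 : ℝ) 1, h ≤ ‖a + t * b‖)
    (hf : ∀ t ∈ Set.Icc (-1 : ℝ) 1, ‖f (c + a + t * b)‖ ≤ M / ‖a + t * b‖ ^ 3) :
    ‖edgeIntegral f (c + a) b‖ ≤ 4 * Real.pi * M / h ^ 2 := by
  -- From the point at t₀ nearest to 0, ‖b‖|t − t₀| ≤ ‖a + tb‖ + ‖a + t₀b‖ ≤ 2‖a + tb‖. This
  -- explains β = ‖b‖/2.
  obtain ⟨t₀, ht₀, hmin⟩ := (isCompact_Icc (a := (-1 : ℝ)) (b := 1)).exists_isMinOn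
    ⟨0, by norm_num⟩ (f := fun t : ℝ => ‖a + t * b‖) (by fun_prop)
  set β := ‖b‖ / 2 with hβ
  have hβ0 : 0 < β := by have := norm_pos_iff.2 hb; positivity
  have hlow : ∀ t ∈ Set.Icc (-1 : ℝ) 1, (h ^ 2 + (β * (t - t₀)) ^ 2) / 2 ≤ ‖a + t * b‖ ^ 2 := by
    intro t ht
    have h1 : |β * (t - t₀)| ≤ ‖a + t * b‖ := by
      have h2 : ‖a + t₀ * b‖ ≤ ‖a + t * b‖ := hmin ht
      have h3 : ‖(((t - t₀ : ℝ) : ℂ)) * b‖ ≤ ‖a + t * b‖ + ‖a + t₀ * b‖ := by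
        refine le_trans (le_of_eq ?_) (norm_sub_le _ _)
        congr 1
        push_cast
        ring
      rw [norm_mul, Complex.norm_real, Real.norm_eq_abs] at h3
      rw [abs_mul, abs_of_pos hβ0, hβ]
      linarith
    have h2 : (β * (t - t₀)) ^ 2 ≤ ‖a + t * b‖ ^ 2 := by
      rw [← sq_abs]; gcongr
    have h3 : h ^ 2 ≤ ‖a + t * b‖ ^ 2 := by
      have := hdist t ht
      gcongr
    linarith
  have hpos : ∀ t : ℝ, 0 < h ^ 2 + (β * (t - t₀)) ^ 2 := fun t => by positivity
  unfold edgeIntegral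
  refine (intervalIntegral.norm_integral_le_of_norm_le
    (g := fun t : ℝ => 4 * M / h * (β / (h ^ 2 + (β * (t - t₀)) ^ 2))) (by norm_num) ?_ ?_).trans ?_
  · refine Eventually.of_forall fun t ht => ?_
    have ht' : t ∈ Set.Icc (-1 : ℝ) 1 := Set.Ioc_subset_Icc_self ht
    have hx := hdist t ht'
    have hl := hlow t ht'
    have hp := hpos t
    rw [norm_mul]
    calc ‖b‖ * ‖f (c + a + t * b)‖ ≤ (2 * β) * (M / ‖a + t * b‖ ^ 3) := by
          rw [hβ, mul_div_cancel₀ _ two_ne_zero]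
          gcongr
          exact hf t ht'
      _ ≤ (2 * β) * (M / (h * ((h ^ 2 + (β * (t - t₀)) ^ 2) / 2))) := by
          have : h * ((h ^ 2 + (β * (t - t₀)) ^ 2) / 2) ≤ ‖a + t * b‖ ^ 3 := by
            rw [pow_succ' _ 2]
            exact mul_le_mul hx hl (by positivity) (norm_nonneg _)
          gcongr
      _ = _ := by field_simp; ring
  · apply Continuous.intervalIntegrable
    have := fun t => (hpos t).ne'
    fun_prop (disch := exact this _)
  · rw [intervalIntegral.integral_const_mul]
    calc _ ≤ 4 * M / h * (Real.pi / h) := by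
          gcongr
          exact integral_one_div_add_sq_le hh hβ0
      _ = _ := by field_simp

/-- The combination of the Cauchy kernel that survives for an even function. -/
lemma norm_even_kernel_le {x w : ℂ} (hx : x ≠ 0) (hxw : 2 * ‖w‖ ≤ ‖x‖) :
    ‖(x - w)⁻¹ - x⁻¹ - ((-x - w)⁻¹ - (-x)⁻¹)‖ ≤ 4 * ‖w‖ ^ 2 / ‖x‖ ^ 3 := by
  have hx0 : 0 < ‖x‖ := norm_pos_iff.2 hx
  have h1 : ‖x‖ ^ 2 / 2 ≤ ‖x ^ 2 - w ^ 2‖ := by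
    have := norm_sub_norm_le (x ^ 2) (w ^ 2)
    rw [norm_pow, norm_pow] at this
    nlinarith [norm_nonneg w]
  have h2 : x ^ 2 - w ^ 2 ≠ 0 := norm_pos_iff.1 (lt_of_lt_of_le (by positivity) h1)
  have h3 : x - w ≠ 0 := fun e => h2 (by linear_combination (x + w) * e)
  have h4 : x + w ≠ 0 := fun e => h2 (by linear_combination (x - w) * e)
  have h5 : -x - w ≠ 0 := fun e => h4 (by linear_combination -e)
  have e : (x - w)⁻¹ - x⁻¹ - ((-x - w)⁻¹ - (-x)⁻¹) = 2 * w ^ 2 / (x * (x ^ 2 - w ^ 2)) := by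
    rw [show -x - w = -(x + w) by ring, inv_neg, inv_neg,
      show x ^ 2 - w ^ 2 = (x - w) * (x + w) by ring]
    field_simp
    ring
  rw [e, norm_div, norm_mul, norm_mul, norm_pow, Complex.norm_ofNat]
  calc 2 * ‖w‖ ^ 2 / (‖x‖ * ‖x ^ 2 - w ^ 2‖) ≤ 2 * ‖w‖ ^ 2 / (‖x‖ * (‖x‖ ^ 2 / 2)) := by gcongr
    _ = _ := by field_simp; ring

/-- Reflection in c exchanges opposite edges; for even g each pair reduces to one edge with the
cubic kernel of `norm_even_kernel_le`. Two pairs, each bounded by 4π · 4M‖ω − c‖²/h², give the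
constant 32π. -/
lemma norm_boxIntegral_even_le {g : ℂ → ℂ} {c u v ω : ℂ} (hu : u ≠ 0) (hv : v ≠ 0) {h M : ℝ}
    (hM : 0 ≤ M) (hh : 0 < h) (hω : 2 * ‖ω - c‖ ≤ h)
    (hdist : ∀ ζ ∈ boxBdry c u v, h ≤ ‖ζ - c‖) (hg : ∀ ζ ∈ boxBdry c u v, ‖g ζ‖ ≤ M)
    (heven : ∀ ζ ∈ boxBdry c u v, g (2 * c - ζ) = g ζ)
    (hcont : ContinuousOn (fun ζ => g ζ * ((ζ - ω)⁻¹ - (ζ - c)⁻¹)) (boxBdry c u v)) :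
    ‖boxIntegral (fun ζ => g ζ * ((ζ - ω)⁻¹ - (ζ - c)⁻¹)) c u v‖ ≤
      32 * Real.pi * M * ‖ω - c‖ ^ 2 / h ^ 2 := by
  set k : ℂ → ℂ := fun ζ => g ζ * ((ζ - ω)⁻¹ - (ζ - c)⁻¹) with hk
  set F : ℂ → ℂ := fun ζ => k ζ + (-1) * k (2 * c - ζ) with hF
  have hcont' : ContinuousOn (fun ζ => (-1) * k (2 * c - ζ)) (boxBdry c u v) :=
    continuousOn_const.fun_mul (hcont.comp (by fun_prop) (mapsTo_boxBdry_reflect c u v))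
  have hsum : boxIntegral k c u v = edgeIntegral F (c + u) v + edgeIntegral F (c + v) (-u) := by
    unfold boxIntegral
    have h1 := edgeIntegral_reflect k c u v
    have h2 := edgeIntegral_reflect k c v (-u)
    rw [neg_neg] at h2
    rw [h1, h2, edgeIntegral_add hcont hcont' fun t ht => right_mem_boxBdry c u v ht,
      edgeIntegral_add hcont hcont' fun t ht => top_mem_boxBdry c u v ht, edgeIntegral_const_mul,
      edgeIntegral_const_mul]
    ring
  have hFb : ∀ ζ ∈ boxBdry c u v, ‖F ζ‖ ≤ (4 * M * ‖ω - c‖ ^ 2) / ‖ζ - c‖ ^ 3 := by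
    intro ζ hζ
    have hd := hdist ζ hζ
    have hne : ζ - c ≠ 0 := norm_pos_iff.1 (hh.trans_le hd)
    have e : F ζ = g ζ * ((ζ - c - (ω - c))⁻¹ - (ζ - c)⁻¹ -
        ((-(ζ - c) - (ω - c))⁻¹ - (-(ζ - c))⁻¹)) := by
      simp only [hF, hk]
      rw [heven ζ hζ, show 2 * c - ζ - ω = -(ζ - c) - (ω - c) by ring,
        show 2 * c - ζ - c = -(ζ - c) by ring, sub_sub_sub_cancel_right]
      ring
    rw [e, norm_mul]
    calc _ ≤ M * (4 * ‖ω - c‖ ^ 2 / ‖ζ - c‖ ^ 3) :=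
          mul_le_mul (hg ζ hζ) (norm_even_kernel_le hne (hω.trans hd)) (norm_nonneg _) hM
      _ = _ := by ring
  have hM' : 0 ≤ 4 * M * ‖ω - c‖ ^ 2 := by positivity
  have edge : ∀ a b : ℂ, b ≠ 0 → (∀ t ∈ Set.Icc (-1 : ℝ) 1, c + a + t * b ∈ boxBdry c u v) →
      ‖edgeIntegral F (c + a) b‖ ≤ 4 * Real.pi * (4 * M * ‖ω - c‖ ^ 2) / h ^ 2 := by
    intro a b hb hmem
    have e : ∀ t : ℝ, c + a + t * b - c = a + t * b := fun t => by ring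
    refine norm_edgeIntegral_le hh hM' hb (fun t ht => ?_) (fun t ht => ?_)
    · rw [← e]; exact hdist _ (hmem t ht)
    · rw [← e]; exact hFb _ (hmem t ht)
  rw [hsum]
  calc _ ≤ _ := norm_add_le _ _
    _ ≤ _ := add_le_add (edge u v hv fun t ht => right_mem_boxBdry c u v ht)
      (edge v (-u) (neg_ne_zero.2 hu) fun t ht => top_mem_boxBdry c u v ht)
    _ = _ := by ring

/-- The function has a finite value even at a pole, so boundedness at one point excludes nothing;
but near a pole |g| → ∞ along the segment. -/
lemma not_isPole_of_bounded_on_segment {g : ℂ → ℂ} {a b : ℂ} (hb : b ≠ 0) {M : ℝ}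
    (hg : ∀ t ∈ Set.Icc (-1 : ℝ) 1, ‖g (a + t * b)‖ ≤ M) {t : ℝ} (ht : t ∈ Set.Icc (-1 : ℝ) 1) :
    ¬ IsPole g (a + t * b) := by
  intro hp
  have hacc : AccPt t (𝓟 (Set.Icc (-1 : ℝ) 1)) :=
    isPreconnected_Icc.preperfect_of_nontrivial
      ⟨-1, by norm_num, 1, by norm_num, by norm_num⟩ t ht
  have hcont : Tendsto (fun τ : ℝ => a + τ * b) (𝓝[≠] t) (𝓝[≠] (a + t * b)) := by
    have hc : Continuous fun τ : ℝ => a + (τ : ℂ) * b := by fun_prop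
    refine tendsto_nhdsWithin_of_tendsto_nhds_of_eventually_within _
      (hc.continuousAt.tendsto.mono_left nhdsWithin_le_nhds) ?_
    filter_upwards [self_mem_nhdsWithin] with τ hτ
    intro e
    have h1 : (τ : ℂ) = t := mul_right_cancel₀ hb (add_left_cancel e)
    exact hτ (by exact_mod_cast h1)
  have hlim := (tendsto_norm_atTop_iff_cobounded.2
    (tendsto_cobounded_of_meromorphicOrderAt_neg hp)).comp hcont
  rw [accPt_iff_frequently_nhdsNE] at hacc
  obtain ⟨τ, h1, h2⟩ := (hacc.and_eventually (hlim.eventually_gt_atTop M)).exists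
  exact absurd (hg τ h1) (not_le.2 h2)

lemma not_isPole_of_bounded_on_bdry {g : ℂ → ℂ} {c u v : ℂ} (hu : u ≠ 0) (hv : v ≠ 0) {M : ℝ}
    (hg : ∀ ζ ∈ boxBdry c u v, ‖g ζ‖ ≤ M) : ∀ ζ ∈ boxBdry c u v, ¬ IsPole g ζ := by
  rintro _ ⟨s, hs, t, ht, h1 | h1, rfl⟩
  · exact not_isPole_of_bounded_on_segment hv
      (fun τ hτ => hg _ ⟨s, hs, τ, hτ, .inl h1, rfl⟩) ht
  · rw [add_right_comm]
    exact not_isPole_of_bounded_on_segment hu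
      (fun τ hτ => hg _ ⟨τ, hτ, t, ht, .inr h1, by ring⟩) hs

end QuarterPlane

end

/-! ### The limit along the parallelograms -/

theorem theorem3
    (S : Finset (ℤ × ℤ)) (hS : QuarterPlane.IsSmallStepSet S) (hns : QuarterPlane.NonSingular S)
    (z : ℝ) (hz : z ∈ Set.Ioo (0 : ℝ) (1 / (S.card : ℝ)))
    (r : ℂ → ℂ) (hr : QuarterPlane.IsRy S z r)
    (P : ℕ → Set ℂ)
    (hnest : ∀ m : ℕ, 1 ≤ m → P m ⊆ P (m + 1))
    (hexh : ∀ w : ℂ, ∃ m : ℕ, 1 ≤ m ∧ w ∈ P m)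
    (hpar : ∀ m : ℕ, 1 ≤ m →
      QuarterPlane.IsParallelogramCenteredAt (QuarterPlane.omegaY₂ S z) (P m))
    (hbound : ∃ C₁ C₂ : ℝ, 0 < C₁ ∧ 0 < C₂ ∧ ∀ m : ℕ, 1 ≤ m → ∀ w ∈ frontier (P m),
      ‖r w‖ ≤ C₁ * m ∧ C₂ * m ≤ ‖w - QuarterPlane.omegaY₂ S z‖) :
    (∀ m : ℕ, 1 ≤ m → {d : ℂ | d ∈ P m ∧ QuarterPlane.IsPole r d}.Finite) ∧
    ∀ ω : ℂ, Tendsto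
      (fun m : ℕ => ∑ᶠ d ∈ {d : ℂ | d ∈ P m ∧ QuarterPlane.IsPole r d},
        (QuarterPlane.principalPart r d ω -
          QuarterPlane.principalPart r d (QuarterPlane.omegaY₂ S z)))
      atTop (𝓝 (r ω - r (QuarterPlane.omegaY₂ S z))) := by
  have hpar' : ∀ m : ℕ, 1 ≤ m → ∃ u v : ℂ, LinearIndependent ℝ ![u, v] ∧
      P m = QuarterPlane.box (QuarterPlane.omegaY₂ S z) u v (Set.Icc (-1) 1) := hpar
  have hfin : ∀ m : ℕ, 1 ≤ m → {d : ℂ | d ∈ P m ∧ QuarterPlane.IsPole r d}.Finite := by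
    intro m hm
    obtain ⟨u, v, -, hP⟩ := hpar' m hm
    rw [hP]
    exact QuarterPlane.finite_setOf_isPole hr.meromorphic
      (QuarterPlane.isCompact_box _ u v isCompact_Icc)
  refine ⟨hfin, fun ω => ?_⟩
  set c := QuarterPlane.omegaY₂ S z with hc
  obtain ⟨C₁, C₂, hC₁, hC₂, hb⟩ := hbound
  obtain ⟨m₀, hm₀, hωm₀⟩ := hexh ω
  have hωP : ∀ m, m₀ ≤ m → ω ∈ P m := fun m hm => by
    induction m, hm using Nat.le_induction with
    | base => exact hωm₀
    | succ m hm ih => exact hnest m (hm₀.trans hm) ih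
  rw [tendsto_iff_norm_sub_tendsto_zero]
  have hlim : Tendsto (fun m : ℕ => 32 * Real.pi * C₁ * ‖ω - c‖ ^ 2 / C₂ ^ 2 / (m : ℝ)) atTop
      (𝓝 0) := tendsto_const_div_atTop_nhds_zero_nat _
  refine squeeze_zero' (Eventually.of_forall fun _ => norm_nonneg _) ?_ hlim
  -- The term 2‖ω − c‖ serves the kernel estimate; the extra 1 keeps ω off the boundary.
  have hlarge : ∀ᶠ m : ℕ in atTop, 2 * ‖ω - c‖ + 1 ≤ C₂ * m := by
    have := (tendsto_natCast_atTop_atTop (R := ℝ)).const_mul_atTop hC₂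
    exact this.eventually_ge_atTop _
  filter_upwards [hlarge, eventually_ge_atTop m₀] with m hm hmm₀
  have hm1 : 1 ≤ m := hm₀.trans hmm₀
  have hmpos : (0 : ℝ) < m := by exact_mod_cast hm1
  obtain ⟨u, v, hLI, hP⟩ := hpar' m hm1
  have hu : u ≠ 0 := by simpa using hLI.ne_zero 0
  have hv : v ≠ 0 := by simpa using hLI.ne_zero 1
  have hbd : ∀ ζ ∈ QuarterPlane.boxBdry c u v, ‖r ζ‖ ≤ C₁ * m ∧ C₂ * m ≤ ‖ζ - c‖ := fun ζ hζ =>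
    hb m hm1 ζ (by rw [hP]; exact QuarterPlane.boxBdry_subset_frontier hLI hζ)
  have hnp := QuarterPlane.not_isPole_of_bounded_on_bdry hu hv fun ζ hζ => (hbd ζ hζ).1
  have hωint : ω ∈ QuarterPlane.box c u v (Set.Ioo (-1) 1) := by
    refine (QuarterPlane.mem_bdry_or_mem_box (hP ▸ hωP m hmm₀)).resolve_left fun h => ?_
    have := (hbd ω h).2
    linarith [norm_nonneg (ω - c)]
  have hcint := QuarterPlane.center_mem_box c u v
  have han : ∀ ζ ∈ QuarterPlane.boxBdry c u v, AnalyticAt ℂ r ζ := fun ζ hζ =>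
    QuarterPlane.analyticAt_of_not_isPole (hr.meromorphic ζ) (hr.value ζ) (hnp ζ hζ)
  have hcr : ContinuousOn r (QuarterPlane.boxBdry c u v) := fun ζ hζ =>
    (han ζ hζ).continuousAt.continuousWithinAt
  -- The symmetry is known only on punctured neighbourhoods; r is continuous at both boundary
  -- points, so it extends to ζ itself.
  have heven : ∀ ζ ∈ QuarterPlane.boxBdry c u v, r (2 * c - ζ) = r ζ := fun ζ hζ => by
    have h1 : ContinuousAt (fun ζ => r (2 * c - ζ)) ζ :=
      ContinuousAt.comp (g := r) (f := fun ζ => 2 * c - ζ) (han _ (QuarterPlane.mapsTo_boxBdry_reflect c u v hζ)).continuousAt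
        (by fun_prop)
    exact ((h1.eventuallyEq_nhds_iff_eventuallyEq_nhdsNE (han ζ hζ).continuousAt).1
      (hr.eventually_reflect hS hns hz ζ)).eq_of_nhds
  have hZ : ∀ d, d ∈ (hfin m hm1).toFinset ↔
      d ∈ QuarterPlane.box c u v (Set.Icc (-1) 1) ∧ QuarterPlane.IsPole r d := fun d => by
    rw [Set.Finite.mem_toFinset, ← hP]; rfl
  have hres := fun {ω : ℂ} => QuarterPlane.boxIntegral_meromorphic_mul_inv_sub (ω := ω) hLI
    hr.meromorphic hr.value hnp hZ
  have hcω := QuarterPlane.continuousOn_inv_sub hLI hωint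
  have hcc := QuarterPlane.continuousOn_inv_sub hLI hcint
  have hest := QuarterPlane.norm_boxIntegral_even_le (g := r) (ω := ω) hu hv
    (M := C₁ * m) (h := C₂ * m) (by positivity) (by positivity) (by linarith)
    (fun ζ hζ => (hbd ζ hζ).2) (fun ζ hζ => (hbd ζ hζ).1) heven (hcr.fun_mul (hcω.sub hcc))
  simp only [mul_sub] at hest
  -- The residue formulas at ω and at c are subtracted; the common factor ∮ dζ/(ζ − c) has norm at
  -- least 1, so it can be dropped from the upper bound.
  rw [QuarterPlane.boxIntegral_sub (hcr.fun_mul hcω) (hcr.fun_mul hcc), hres hωint, hres hcint,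
    ← sub_mul, norm_mul] at hest
  have hsum := finsum_mem_eq_finite_toFinset_sum (fun d => QuarterPlane.principalPart r d ω -
    QuarterPlane.principalPart r d c) (hfin m hm1)
  refine (congrArg (fun x => ‖x - (r ω - r c)‖) hsum).trans_le ?_
  rw [Finset.sum_sub_distrib, norm_sub_rev]
  calc _ = ‖r ω - ∑ d ∈ (hfin m hm1).toFinset, QuarterPlane.principalPart r d ω -
        (r c - ∑ d ∈ (hfin m hm1).toFinset, QuarterPlane.principalPart r d c)‖ := by
          congr 1; ring
    _ ≤ _ := le_mul_of_one_le_right (norm_nonneg _)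
          (QuarterPlane.one_le_norm_boxIntegral_inv_sub_center (c := c) hLI)
    _ ≤ _ := hest
    _ = _ := by field_simp
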